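/- Let $\mathbb K\in\{\mathbb R,\mathbb C,\mathbb H\}$, $d=\dim_{\mathbb R}\mathbb K$, let $1\le p\le q$ and $n+1=p+q$. Let $G=\mathrm{SL}(n+1,\mathbb K)$ (for $\mathbb K=\mathbb H$: the matrices whose determinant as an $\mathbb R$-linear map is $1$), $K=\{x\in G: x^*=x^{-1}\}$ with its normalized Haar measure $dk$, and write matrices in blocks of sizes $p,q$. Put $H_o=\mathrm{diag}\big(\tfrac{q}{n+1}I_p,-\tfrac{p}{n+1}I_q\big)$, $A=\exp(\mathbb R H_o)$, $M=\{\mathrm{diag}(a,b)\in G: |\det_{\mathbb R} a|=1\}$, $N=\{\begin{pmatrix} I_p&X\\0&I_q\end{pmatrix}\}$, $\overline N=\{\begin{pmatrix} I_p&0\\Y&I_q\end{pmatrix}\}$, and let $P=MAN$ be the group of block upper triangular matrices in $G$. For $z\in\mathbb C$ put $\exp(tH_o)^z:=e^{z t pq/(n+1)}$. For $x\in\overline N P$ (an open dense subset of $G$ that contains almost every element of $K$) let $\alpha_P(x)\in A$ be the $A$-component of $x$ in $\overline N MAN$; for $x\in G=KMAN$ let $a_P(x)\in A$ be the $A$-component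 of $x$. Let $\rho=d(n+1)/2$, and normalize the Haar measure of $\overline N$ by $\int_{\overline N}a_P(\bar n)^{-2\rho}\,d\bar n=1$. For functions $f$ on $\mathcal B=G/P$ with base point $b_o=eP$ and for $k\in K$ let $$J(\lambda)f(k\cdot b_o)=\int_{\overline N}a_P(\bar n)^{-\lambda-\rho}f(k\bar n\cdot b_o)\,d\bar n .$$ For $z\in\mathbb C$ let $\Gamma_{p,d}(z)=\prod_{j=1}^p\Gamma\big(z-\tfrac d2(j-1)\big)$. Then for every $\lambda\in\mathbb C$ with $\operatorname{Re}\lambda>\rho-d$ the integral $c_P(\lambda):=\int_K\alpha_P(k)^{\lambda-\rho}\,dk$ and the integral $\int_{\overline N}a_P(\bar n)^{-\lambda-\rho}\,d\bar n$ that defines $J(\lambda)1$ converge absolutely, $J(\lambda)$ acts on the constant functions as multiplication by $c_P(\lambda)$ (in particular $J(\lambda)1=c_P(\lambda)$), and $$c_P(\lambda)=\frac{\Gamma_{p,d}\left(d(n+1)/2\right)}{\Gamma_{p,d}\left(dp/2\right)}\,\frac{\Gamma_{p,d}\left(\tfrac12(\lambda-\rho+dp)\right)}{\Gamma_{p,d}\left(\tfrac12(\lambda+\rho)\right)}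 .$$ The right-hand side is meromorphic on $\mathbb C$, and every meromorphic function on $\mathbb C$ that agrees with $c_P$ on some right half-plane equals it off a closed discrete set; so the formula holds for the meromorphic continuation of $c_P$ to $\mathbb C$. -/

import Mathlib

open MeasureTheory Matrix
open scoped Quaternion

noncomputable section
namespace CosLambda

/-! ### The scalars `𝕂 = ℝ, ℂ, ℍ` -/

/-- The three possible (skew) fields of scalars. -/
inductive ScalarField : Type
  | real
  | complex
  | quaternion

/-- The underlying (skew) field `ℝ`, `ℂ` or `ℍ`. -/
def ScalarField.Carrier : ScalarField → Type
  | .real => ℝ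
  | .complex => ℂ
  | .quaternion => ℍ[ℝ]

instance : CoeSort ScalarField Type := ⟨ScalarField.Carrier⟩

instance (F : ScalarField) : NormedDivisionRing F :=
  match F with
  | .real => inferInstanceAs (NormedDivisionRing ℝ)
  | .complex => inferInstanceAs (NormedDivisionRing ℂ)
  | .quaternion => inferInstanceAs (NormedDivisionRing ℍ[ℝ])

instance (F : ScalarField) : NormedAlgebra ℝ F :=
  match F with
  | .real => inferInstanceAs (NormedAlgebra ℝ ℝ)
  | .complex => inferInstanceAs (NormedAlgebra ℝ ℂ)
  | .quaternion => inferInstanceAs (NormedAlgebra ℝ ℍ[ℝ])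

/-- `star` is the canonical conjugation of `𝕂`. -/
instance (F : ScalarField) : StarRing F :=
  match F with
  | .real => inferInstanceAs (StarRing ℝ)
  | .complex => inferInstanceAs (StarRing ℂ)
  | .quaternion => inferInstanceAs (StarRing ℍ[ℝ])

instance (F : ScalarField) : FiniteDimensional ℝ F :=
  match F with
  | .real => inferInstanceAs (FiniteDimensional ℝ ℝ)
  | .complex => inferInstanceAs (FiniteDimensional ℝ ℂ)
  | .quaternion => inferInstanceAs (FiniteDimensional ℝ ℍ[ℝ])

theorem star_mul_self_eq (F : ScalarField) (a : F) :
    star a * a = algebraMap ℝ F (‖a‖ ^ 2) := by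
  have hR : ∀ a : ℝ, star a * a = algebraMap ℝ ℝ (‖a‖ ^ 2) := fun a => by simp [sq]
  have hC : ∀ a : ℂ, star a * a = algebraMap ℝ ℂ (‖a‖ ^ 2) := fun a => by
    simpa using Complex.conj_mul' a
  have hH : ∀ a : ℍ[ℝ], star a * a = algebraMap ℝ ℍ[ℝ] (‖a‖ ^ 2) := fun a => by
    rw [Quaternion.star_mul_self, Quaternion.normSq_eq_norm_mul_self, sq]
    rfl
  match F, a with
  | .real, a => exact hR a
  | .complex, a => exact hC a
  | .quaternion, a => exact hH a

instance (F : ScalarField) : ProperSpace F := FiniteDimensional.proper ℝ F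

instance (F : ScalarField) : NormedStarGroup F where
  norm_star_le a := by
    have h : ‖star a‖ * ‖a‖ = ‖a‖ * ‖a‖ := by
      rw [← norm_mul, star_mul_self_eq, norm_algebraMap', norm_pow, norm_norm, sq]
    rcases eq_or_ne a 0 with rfl | ha
    · simp
    · exact (mul_right_cancel₀ (norm_ne_zero_iff.2 ha) h).le

instance (F : ScalarField) : MeasurableSpace F := borel F

instance (F : ScalarField) : BorelSpace F := ⟨rfl⟩

/-- `d = dim_ℝ 𝕂`, that is `1`, `2`, `4` for `ℝ`, `ℂ`, `ℍ`. -/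
def ScalarField.d (F : ScalarField) : ℕ := Module.finrank ℝ F

/-! ### Determinants and the group `SL(m, 𝕂)` -/

section Determinant

variable {F : ScalarField} {ι : Type} [Fintype ι] [DecidableEq ι]

/-- A square matrix over `𝕂` acting on column vectors, as an `ℝ`-linear map. -/
def realAction : Matrix ι ι F →* Module.End ℝ (ι → F) where
  toFun x :=
    { toFun := fun v => x *ᵥ v
      map_add' := fun v w => Matrix.mulVec_add x v w
      map_smul' := fun c v => Matrix.mulVec_smul x c v }
  map_one' := LinearMap.ext fun v => by simp
  map_mul' x y := LinearMap.ext fun v => by simp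

/-- `det_ℝ x`: the determinant of `x` as an `ℝ`-linear map of `𝕂^m`. -/
def realDet : Matrix ι ι F →* ℝ := LinearMap.det.comp realAction

end Determinant

/-- `SL(m, 𝕂)`: for `ℝ` and `ℂ` the matrices of determinant one. For `ℍ` the (Dieudonné)
determinant is the positive real number whose fourth power is `det_ℝ`, so that it is one exactly
if `det_ℝ` is. -/
def specialLinear (F : ScalarField) (ι : Type) [Fintype ι] [DecidableEq ι] :
    Subgroup (Matrix ι ι F)ˣ :=
  match F with
  | .real => ((Matrix.detMonoidHom : Matrix ι ι ℝ →* ℝ).comp (Units.coeHom _)).ker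
  | .complex => ((Matrix.detMonoidHom : Matrix ι ι ℂ →* ℂ).comp (Units.coeHom _)).ker
  | .quaternion => (realDet.comp (Units.coeHom _)).ker

theorem commutator_mem_ker {G M : Type} [Group G] [CommMonoid M] (f : G →* M) (g h : G) :
    g * h * g⁻¹ * h⁻¹ ∈ f.ker := by
  rw [MonoidHom.mem_ker, map_mul, map_mul, map_mul, mul_right_comm (f g), ← map_mul f g g⁻¹,
    mul_inv_cancel, map_one, one_mul, ← map_mul, mul_inv_cancel, map_one]

theorem commutator_mem_specialLinear (F : ScalarField) {ι : Type} [Fintype ι] [DecidableEq ι]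
    (g h : (Matrix ι ι F)ˣ) : g * h * g⁻¹ * h⁻¹ ∈ specialLinear F ι := by
  match F, g, h with
  | .real, g, h => exact commutator_mem_ker _ g h
  | .complex, g, h => exact commutator_mem_ker _ g h
  | .quaternion, g, h => exact commutator_mem_ker _ g h

theorem isClosed_specialLinear (F : ScalarField) {ι : Type} [Fintype ι] [DecidableEq ι] :
    ∃ S : Set (Matrix ι ι F), IsClosed S ∧ ∀ x, x ∈ specialLinear F ι ↔ (x : Matrix ι ι F) ∈ S := by
  have hR : IsClosed {x : Matrix ι ι ℝ | x.det = 1} :=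
    isClosed_eq (Continuous.matrix_det continuous_id) continuous_const
  have hC : IsClosed {x : Matrix ι ι ℂ | x.det = 1} :=
    isClosed_eq (Continuous.matrix_det continuous_id) continuous_const
  match F with
  | .real => exact ⟨{x : Matrix ι ι ℝ | x.det = 1}, hR, fun x => Iff.rfl⟩
  | .complex => exact ⟨{x : Matrix ι ι ℂ | x.det = 1}, hC, fun x => Iff.rfl⟩
  | .quaternion =>
    refine ⟨{x | realDet x = 1}, isClosed_eq ?_ continuous_const, fun x => Iff.rfl⟩
    let T : Matrix ι ι ScalarField.quaternion →ₗ[ℝ]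
        ((ι → ScalarField.quaternion) →L[ℝ] (ι → ScalarField.quaternion)) :=
      { toFun := fun x => LinearMap.toContinuousLinearMap (realAction x)
        map_add' := fun x y => by
          ext1 v
          exact Matrix.add_mulVec x y v
        map_smul' := fun c x => by
          ext1 v
          exact Matrix.smul_mulVec c x v }
    have hT : Continuous T := T.continuous_of_finiteDimensional
    exact ContinuousLinearMap.continuous_det.comp hT

/-! ### The group `G = SL(n+1, 𝕂)` in blocks, `n + 1 = p + q` -/

section Groups

variable (F : ScalarField) (p q : ℕ)

/-- The `(p+q) × (p+q)` matrices over `𝕂`, in blocks. -/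
abbrev Mat : Type := Matrix (Fin p ⊕ Fin q) (Fin p ⊕ Fin q) F

/-- `G = SL(p + q, 𝕂)`. -/
abbrev G : Type := ↥(specialLinear F (Fin p ⊕ Fin q))

/-- The underlying matrix of an element of `G`. -/
def G.mat {F : ScalarField} {p q : ℕ} (x : G F p q) : Mat F p q := ((x : (Mat F p q)ˣ) : Mat F p q)

/-- `K = SU(p + q, 𝕂) = {x ∈ G | x* = x⁻¹}`. -/
def K : Subgroup (G F p q) where
  carrier := {x | star x.mat * x.mat = 1}
  one_mem' := by simp [G.mat]
  mul_mem' := by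
    intro x y hx hy
    simp only [Set.mem_ofPred_eq, G.mat, Subgroup.coe_mul, Units.val_mul, star_mul] at *
    rw [mul_assoc, ← mul_assoc (star (x : (Mat F p q)ˣ).val), hx, one_mul, hy]
  inv_mem' := by
    intro x hx
    simp only [Set.mem_ofPred_eq, G.mat, Subgroup.coe_inv] at *
    rw [← Units.eq_inv_of_mul_eq_one_right hx, star_star, Units.eq_inv_of_mul_eq_one_right hx]
    exact Units.mul_inv _

/-- The maximal parabolic subgroup `P` of block upper triangular matrices in `G`. -/
def P : Subgroup (G F p q) where
  carrier := {x | ∃ (a : (Matrix (Fin p) (Fin p) F)ˣ) (b : (Matrix (Fin q) (Fin q) F)ˣ)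
    (X : Matrix (Fin p) (Fin q) F), x.mat = fromBlocks a.val X 0 b.val}
  one_mem' := ⟨1, 1, 0, by simp [G.mat]⟩
  mul_mem' := by
    rintro x y ⟨a, b, X, hx⟩ ⟨a', b', X', hy⟩
    refine ⟨a * a', b * b', a.val * X' + X * b'.val, ?_⟩
    have : (x * y).mat = x.mat * y.mat := rfl
    rw [this, hx, hy, fromBlocks_multiply]
    simp
  inv_mem' := by
    rintro x ⟨a, b, X, hx⟩
    refine ⟨a⁻¹, b⁻¹, -(a⁻¹.val * X * b⁻¹.val), ?_⟩
    change ((x : (Mat F p q)ˣ)⁻¹).val = _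
    symm
    apply Units.eq_inv_of_mul_eq_one_right
    change _ * x.mat = 1
    rw [hx, fromBlocks_multiply]
    simp [Matrix.mul_assoc]

/-- The Grassmann manifold `𝓑 = Gr_p(𝕂) = G / P`. -/
abbrev B : Type := G F p q ⧸ P F p q

variable {F p q}

/-- `n(X)`, a general element of the group `N`. -/
def nMat (X : Matrix (Fin p) (Fin q) F) : Mat F p q := fromBlocks 1 X 0 1

/-- `n̄(Y)`, a general element of the group `N̄`. -/
def nbarMat (Y : Matrix (Fin q) (Fin p) F) : Mat F p q := fromBlocks 1 0 Y 1

theorem nbarMat_mul (Y Z : Matrix (Fin q) (Fin p) F) :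
    nbarMat Y * nbarMat Z = nbarMat (Y + Z) := by
  simp [nbarMat, fromBlocks_multiply]

theorem nbarMat_zero : nbarMat (0 : Matrix (Fin q) (Fin p) F) = 1 := by
  simp [nbarMat]

/-- `n̄(Y)` as an invertible matrix. -/
def nbarUnit (Y : Matrix (Fin q) (Fin p) F) : (Mat F p q)ˣ where
  val := nbarMat Y
  inv := nbarMat (-Y)
  val_inv := by rw [nbarMat_mul, add_neg_cancel, nbarMat_zero]
  inv_val := by rw [nbarMat_mul, neg_add_cancel, nbarMat_zero]

theorem nbarUnit_mem (Y : Matrix (Fin q) (Fin p) F) :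
    nbarUnit Y ∈ specialLinear F (Fin p ⊕ Fin q) := by
  let g : (Mat F p q)ˣ :=
    { val := fromBlocks 1 0 0 ((2 : ℝ) • 1)
      inv := fromBlocks 1 0 0 ((2⁻¹ : ℝ) • 1)
      val_inv := by simp [fromBlocks_multiply]
      inv_val := by simp [fromBlocks_multiply] }
  have h : nbarUnit Y = g * nbarUnit Y * g⁻¹ * (nbarUnit Y)⁻¹ := by
    rw [eq_mul_inv_iff_mul_eq, eq_mul_inv_iff_mul_eq]
    ext1
    change nbarMat Y * nbarMat Y * fromBlocks 1 0 0 ((2 : ℝ) • 1)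
      = fromBlocks 1 0 0 ((2 : ℝ) • 1) * nbarMat Y
    simp [nbarMat, fromBlocks_multiply, ← two_smul ℝ]
  rw [h]
  exact commutator_mem_specialLinear F _ _

/-- `n̄(Y)` as an element of `G`. -/
def nbar (Y : Matrix (Fin q) (Fin p) F) : G F p q := ⟨nbarUnit Y, nbarUnit_mem Y⟩

variable (F p q) in
/-- `H_o = diag((q/(n+1)) I_p, -(p/(n+1)) I_q)` with `n + 1 = p + q`; `𝔞 = ℝ H_o`. -/
def Ho : Mat F p q :=
  fromBlocks (((q : ℝ) / ((p : ℝ) + q)) • 1) 0 0 ((-((p : ℝ) / ((p : ℝ) + q))) • 1)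

variable (F p q) in
/-- `exp (t H_o)`, a general element of the group `A = exp 𝔞`. -/
def aMat (t : ℝ) : Mat F p q := NormedSpace.exp (t • Ho F p q)

variable (F p q) in
theorem aMat_eq (t : ℝ) : aMat F p q t =
    fromBlocks (Real.exp (t * ((q : ℝ) / ((p : ℝ) + q))) • 1) 0 0
      (Real.exp (t * (-((p : ℝ) / ((p : ℝ) + q)))) • 1) := by
  have hd : ∀ r s : ℝ, (fromBlocks (r • 1) 0 0 (s • 1) : Mat F p q) =
      diagonal (Sum.elim (fun _ => algebraMap ℝ F r) (fun _ => algebraMap ℝ F s)) := by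
    intro r s
    rw [← fromBlocks_diagonal, Algebra.algebraMap_eq_smul_one, Algebra.algebraMap_eq_smul_one]
    congr 1 <;> ext i j <;> by_cases h : i = j <;> simp [h]
  have he : ∀ r : ℝ, NormedSpace.exp (algebraMap ℝ F r) = algebraMap ℝ F (Real.exp r) := by
    intro r
    rw [Real.exp_eq_exp_ℝ, NormedSpace.algebraMap_exp_comm]
  let : NormedAlgebra ℚ F := NormedAlgebra.restrictScalars ℚ ℝ F
  rw [aMat, Ho, fromBlocks_smul, smul_smul, smul_smul, smul_zero, smul_zero, hd, hd,
    Matrix.exp_diagonal]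
  congr 1
  funext i
  rw [Pi.coe_exp]
  cases i
  · exact he _
  · exact he _

variable (F p q) in
/-- The group `M`: block diagonal `m(a, b) ∈ G` with `|det a| = 1` (hence also `|det b| = 1`).
Recall `|det_ℝ a| = |det a| ^ d`. -/
def M : Set (G F p q) :=
  {x | ∃ (a : Matrix (Fin p) (Fin p) F) (b : Matrix (Fin q) (Fin q) F),
    x.mat = fromBlocks a 0 0 b ∧ |realDet a| = 1}

/-- `x = n̄ m exp(t H_o) n` for some `n̄ ∈ N̄`, `m ∈ M`, `n ∈ N`, i.e. `x ∈ N̄ P` and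
`α_P(x) = exp(t H_o)`. -/
def IsAlpha (x : G F p q) (t : ℝ) : Prop :=
  ∃ (Y : Matrix (Fin q) (Fin p) F) (m : G F p q) (X : Matrix (Fin p) (Fin q) F),
    m ∈ M F p q ∧ x.mat = nbarMat Y * m.mat * aMat F p q t * nMat X

/-- `x = k m exp(t H_o) n` for some `k ∈ K`, `m ∈ M`, `n ∈ N`, i.e. `a_P(x) = exp(t H_o)`. -/
def IsIwasawa (x : G F p q) (t : ℝ) : Prop :=
  ∃ (k m : G F p q) (X : Matrix (Fin p) (Fin q) F),
    k ∈ K F p q ∧ m ∈ M F p q ∧ x.mat = k.mat * m.mat * aMat F p q t * nMat X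

variable (p q) in
/-- `exp(t H_o) ^ z`. The number `z ∈ ℂ` stands for the element `z (pq/(n+1)) α` of `𝔞_ℂ^*`,
where `α(H_o) = 1`. -/
def aPow (t : ℝ) (z : ℂ) : ℂ := Complex.exp (z * ((p : ℂ) * q / ((p : ℂ) + q)) * t)

open Classical in
/-- `α_P(x) ^ z` for `x ∈ N̄ P` (and `0` outside the open dense set `N̄ P`, where `α_P` is
not defined). -/
def alphaPow (x : G F p q) (z : ℂ) : ℂ :=
  if h : ∃ t, IsAlpha x t then aPow p q h.choose z else 0

open Classical in
/-- `a_P(x) ^ z` for `x ∈ G = K M A N`. -/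
def iwasawaPow (x : G F p q) (z : ℂ) : ℂ :=
  if h : ∃ t, IsIwasawa x t then aPow p q h.choose z else 0

end Groups

/-! ### Invariant measures -/

section Measures

variable (F : ScalarField) (p q : ℕ)

instance : MeasurableSpace (K F p q) := borel _

instance : BorelSpace (K F p q) := ⟨rfl⟩

instance : CompactSpace (K F p q) := by
  obtain ⟨S, hS, hSG⟩ := isClosed_specialLinear F (ι := Fin p ⊕ Fin q)
  let C : Set (Mat F p q) := {x | star x * x = 1 ∧ x * star x = 1 ∧ x ∈ S}
  have hcl : IsClosed C := by
    have h1 : IsClosed {x : Mat F p q | star x * x = 1} :=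
      isClosed_eq (continuous_star.mul continuous_id) continuous_const
    have h2 : IsClosed {x : Mat F p q | x * star x = 1} :=
      isClosed_eq (continuous_id.mul continuous_star) continuous_const
    exact h1.inter (h2.inter hS)
  have hsub : C ⊆ Set.pi Set.univ
      (fun _ => Set.pi Set.univ (fun _ => Metric.closedBall (0 : F) 1)) := by
    rintro x ⟨hx, -, -⟩ i - j -
    rw [mem_closedBall_zero_iff]
    have h := congrFun (congrFun hx j) j
    rw [Matrix.mul_apply, Matrix.one_apply_eq] at h
    simp only [Matrix.star_apply, star_mul_self_eq, ← map_sum] at h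
    rw [← map_one (algebraMap ℝ F)] at h
    have h' := (algebraMap ℝ F).injective h
    have h'' : ‖x i j‖ ^ 2 ≤ 1 := by
      rw [← h']
      exact Finset.single_le_sum (f := fun k => ‖x k j‖ ^ 2) (fun _ _ => by positivity)
        (Finset.mem_univ i)
    nlinarith [norm_nonneg (x i j)]
  have hC : IsCompact C := by
    refine IsCompact.of_isClosed_subset ?_ hcl hsub
    exact isCompact_univ_pi fun _ => isCompact_univ_pi fun _ => isCompact_closedBall _ _
  have : CompactSpace C := isCompact_iff_compactSpace.1 hC
  let u : C → (Mat F p q)ˣ := fun x => ⟨x.1, star x.1, x.2.2.1, x.2.1⟩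
  have hu : Continuous u := Units.continuous_iff.2
    ⟨continuous_subtype_val, continuous_star.comp continuous_subtype_val⟩
  let ψ : C → K F p q := fun x => ⟨⟨u x, (hSG _).2 x.2.2.2⟩, x.2.1⟩
  have hψ : Continuous ψ := (hu.subtype_mk _).subtype_mk _
  refine Function.Surjective.compactSpace (f := ψ) hψ ?_
  rintro ⟨⟨x, hx⟩, hk⟩
  have hk' : star x.val * x.val = 1 := hk
  have hinv : star x.val = x⁻¹.val := Units.eq_inv_of_mul_eq_one_right hk'
  exact ⟨⟨x.val, hk', by rw [hinv]; exact x.mul_inv, (hSG x).1 hx⟩,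
    Subtype.ext (Subtype.ext (Units.ext rfl))⟩

/-- `dk`: the Haar measure of the compact group `K` of total mass one. -/
def haarK : Measure (K F p q) := Measure.haarMeasure ⊤

/-- `ρ = d(n+1)/2`, the number that corresponds to half the sum of the positive roots,
`(dpq/2) α`. -/
def rho : ℝ := (F.d : ℝ) * ((p : ℝ) + q) / 2

/-- `d n̄`: the Haar measure of `N̄`, transported to `M_{q×p}(𝕂)` by `n̄(Y) ↔ Y`, normalized by
`∫ a_P(n̄) ^ (-2ρ) d n̄ = 1`. -/
def haarNbar : Measure (Fin q → Fin p → F) :=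
  (∫⁻ Y : Fin q → Fin p → F, ‖iwasawaPow (nbar (Matrix.of Y)) (-(2 * rho F p q))‖ₑ
    ∂Measure.addHaar)⁻¹ • Measure.addHaar

end Measures

/-! ### The function `c_P` and the intertwining operator `J(λ)` -/

section Main

variable (F : ScalarField) (p q : ℕ)

/-- `∫_K α_P(k) ^ (λ - ρ) dk`. -/
def cP (lam : ℂ) : ℂ := ∫ k : K F p q, alphaPow (k : G F p q) (lam - rho F p q) ∂haarK F p q

/-- The value at `k · b_o` of the standard intertwining operator,
`J(λ) f (k · b_o) = ∫_{N̄} a_P(n̄) ^ (-λ - ρ) f(k n̄ · b_o) d n̄`. -/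
def J (lam : ℂ) (f : B F p q → ℂ) (k : K F p q) : ℂ :=
  ∫ Y : Fin q → Fin p → F,
    iwasawaPow (nbar (Matrix.of Y)) (-lam - rho F p q) *
      f (QuotientGroup.mk ((k : G F p q) * nbar (Matrix.of Y))) ∂haarNbar F p q

/-- The Siegel (Gindikin) Gamma function `Γ_{p,d}(z) = ∏_{j=1}^p Γ(z_j - (d/2)(j-1))`. -/
def siegelGamma (p d : ℕ) (z : Fin p → ℂ) : ℂ :=
  ∏ j : Fin p, Complex.Gamma (z j - (d : ℂ) / 2 * (j : ℕ))

/-- The quotient of Gamma functions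
`Γ_{p,d}(d(n+1)/2) Γ_{p,d}((λ-ρ+dp)/2) / (Γ_{p,d}(dp/2) Γ_{p,d}((λ+ρ)/2))`; a number stands for
the constant vector. -/
def gammaQuotient (lam : ℂ) : ℂ :=
  siegelGamma p F.d (fun _ => (F.d : ℂ) * ((p : ℂ) + q) / 2) /
      siegelGamma p F.d (fun _ => (F.d : ℂ) * p / 2) *
    (siegelGamma p F.d (fun _ => (lam - rho F p q + F.d * p) / 2) /
      siegelGamma p F.d (fun _ => (lam + rho F p q) / 2))

end Main

end CosLambda
end

noncomputable section
namespace CosLambda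

/-! ### The conjugation of `𝕂` and the real trace form -/

section Scalars

variable {F : ScalarField}

/-! Both integrals are moments of a single random variable, and a Gaussian matrix computes them.

All quantities are read off from real determinants. The factors `N̄` and `N` do not change the upper
left block determinant, and `M` has `|det_ℝ a| = 1`, so `α_P(x)^z = |det_ℝ x₁₁|^(z/d)`. In the same
way `a_P(n̄(Y))^z = v(Y)^(z/d)`, where `v(Y)` (`nbarVol`) is the square root of the real determinant
of the Gram matrix of the first `p` columns of `n̄(Y)`. In particular `a_P^(-2ρ) = v^(-(p+q))`.

Give a `(p+q) × p` matrix `Z`, with upper block `Z₁`, the weight `exp(-|Z|²)`. Almost surely `Z`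
consists of `Z₁` above `Y Z₁`. Writing the first `p` columns of `n̄(Y)` as an isometry times `b` and
putting `W = b Z₁`, one finds `|Z| = |W|`, `|det Z₁| = |det W| / v(Y)`, and that `Y` and `W`
separate, with densities `v(Y)^(-(p+q))` and `|det W|^q exp(-|W|²)` (`lintegral_gram`). Two
consequences follow.

First, the Gaussian is invariant under `K`, so the ratio of `|det Z₁|` to the Gram volume of `Z` is
distributed like `|det_ℝ k₁₁|` under `dk` (`lintegral_blockDet`); in the new coordinates this ratio
is `1/v(Y)`. Hence `|det_ℝ k₁₁|` under `dk` and `1/v` under `a_P(n̄)^(-2ρ) dn̄` have the same law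
(`map_blockDet`), which gives `J(λ)1 = c_P(λ)`.

Secondly, `|det Z₁|` is the product of the independent variables `1/v(Y)` and `|det W|`
(`map_absDet_gaussMat`). So the moment of `1/v` of order `s = (λ - ρ)/d` is a quotient of Gaussian
moments of `|det|` of orders `s` and `s + q`, normalized at `s = 0` (`nbarLaw_moment`). Those
moments are products of Gamma values: rotating the first row onto an axis splits off one radial
factor and lowers the size by one (`gaussMat_moment`). They converge for `Re s > -1`, that is, for
`Re λ > ρ - d`. -/

theorem add_star_self_eq (a : F) :
    a + star a = algebraMap ℝ F (‖a + 1‖ ^ 2 - ‖a‖ ^ 2 - 1) := by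
  have h := star_mul_self_eq F (a + 1)
  rw [map_sub, map_sub, ← h, ← star_mul_self_eq, map_one, star_add, star_one]
  noncomm_ring

theorem star_algebraMap (r : ℝ) : star (algebraMap ℝ F r) = algebraMap ℝ F r := by
  have hR : ∀ r : ℝ, star (algebraMap ℝ ℝ r) = algebraMap ℝ ℝ r := fun r => by simp
  have hC : ∀ r : ℝ, star (algebraMap ℝ ℂ r) = algebraMap ℝ ℂ r := fun r => by simp
  have hH : ∀ r : ℝ, star (algebraMap ℝ ℍ[ℝ] r) = algebraMap ℝ ℍ[ℝ] r := fun r => by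
    exact Quaternion.star_coe r
  match F with
  | .real => exact hR r
  | .complex => exact hC r
  | .quaternion => exact hH r

instance : StarModule ℝ F where
  star_smul r a := by
    rw [Algebra.smul_def, star_mul, star_algebraMap, ← Algebra.commutes, ← Algebra.smul_def,
      star_trivial r]

variable (F) in
/-- Twice the real part of an element of `𝕂`. -/
def traceForm : F →ₗ[ℝ] ℝ where
  -- Polarization of the norm expresses `2 Re a` by one formula for `ℝ`, `ℂ` and `ℍ`, so no case
  -- distinction is needed.
  toFun a := ‖a + 1‖ ^ 2 - ‖a‖ ^ 2 - 1
  map_add' a b := by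
    apply (algebraMap ℝ F).injective
    rw [map_add, ← add_star_self_eq, ← add_star_self_eq, ← add_star_self_eq, star_add]
    abel
  map_smul' r a := by
    apply (algebraMap ℝ F).injective
    rw [RingHom.id_apply, smul_eq_mul, map_mul, ← add_star_self_eq, ← add_star_self_eq, star_smul,
      star_trivial, ← Algebra.smul_def, smul_add]

theorem algebraMap_traceForm (a : F) : algebraMap ℝ F (traceForm F a) = a + star a :=
  (add_star_self_eq a).symm

theorem traceForm_star_mul_self (a : F) : traceForm F (star a * a) = 2 * ‖a‖ ^ 2 := by
  apply (algebraMap ℝ F).injective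
  rw [algebraMap_traceForm, star_mul, star_star, star_mul_self_eq, ← map_add, two_mul]

/-- Conjugation of vectors over `𝕂`. -/
def starVec (F : ScalarField) (ι : Type) : (ι → F) ≃ₗ[ℝ] (ι → F) where
  toFun v := star v
  invFun v := star v
  left_inv v := star_star v
  right_inv v := star_star v
  map_add' v w := star_add v w
  map_smul' r v := by simp

end Scalars

/-! ### The real determinant -/

section Pairing

variable {F : ScalarField} {ι : Type} [Fintype ι]

/-- The real inner product on `𝕂^m`, up to a factor of two, as a map to the dual space. -/
def pairing (F : ScalarField) (ι : Type) [Fintype ι] : (ι → F) →ₗ[ℝ] Module.Dual ℝ (ι → F) :=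
  LinearMap.mk₂ ℝ (fun v w => ∑ i, traceForm F (star (v i) * w i))
    (fun v v' w => by simp [add_mul, Finset.sum_add_distrib])
    (fun r v w => by simp [Finset.mul_sum])
    (fun v w w' => by simp [mul_add, Finset.sum_add_distrib])
    (fun r v w => by simp [Finset.mul_sum])

theorem pairing_apply (v w : ι → F) :
    pairing F ι v w = ∑ i, traceForm F (star (v i) * w i) := rfl

theorem pairing_injective : Function.Injective (pairing F ι) := by
  rw [injective_iff_map_eq_zero]
  intro v hv
  have h : ∑ i, 2 * ‖v i‖ ^ 2 = 0 := by
    simpa [pairing_apply, traceForm_star_mul_self] using LinearMap.congr_fun hv v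
  rw [Finset.sum_eq_zero_iff_of_nonneg (fun i _ => by positivity)] at h
  funext i
  simpa using h i (Finset.mem_univ i)

theorem pairing_mulVec (x : Matrix ι ι F) (v w : ι → F) :
    pairing F ι (x *ᵥ v) w = pairing F ι v (star x *ᵥ w) := by
  simp only [pairing_apply, mulVec, dotProduct, star_sum, star_mul, Finset.sum_mul, Finset.mul_sum,
    map_sum, star_apply, mul_assoc]
  exact Finset.sum_comm

end Pairing

section RealDet

variable {F : ScalarField} {ι κ : Type} [Fintype ι] [DecidableEq ι] [Fintype κ] [DecidableEq κ]

@[simp]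
theorem realAction_apply (x : Matrix ι ι F) (v : ι → F) : realAction x v = x *ᵥ v := rfl

theorem realDet_apply (x : Matrix ι ι F) : realDet x = LinearMap.det (realAction x) := rfl

/-- For the real inner product `pairing`, `star x` is the adjoint of `x`. The pairing identifies the
space with its dual and turns the adjoint into the dual map, which has the same determinant. -/
theorem realDet_star (x : Matrix ι ι F) : realDet (star x) = realDet x := by
  let e : (ι → F) ≃ₗ[ℝ] Module.Dual ℝ (ι → F) :=
    LinearEquiv.ofInjectiveOfFinrankEq (pairing F ι) pairing_injective
      Subspace.dual_finrank_eq.symm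
  rw [realDet_apply, realDet_apply, ← LinearMap.det_dualMap (realAction (star x)),
    ← LinearMap.det_conj (realAction x) e]
  congr 1
  refine LinearMap.ext fun f => LinearMap.ext fun w => ?_
  obtain ⟨v, rfl⟩ := e.surjective f
  rw [LinearMap.comp_apply, LinearMap.comp_apply, LinearEquiv.coe_coe, LinearEquiv.coe_coe,
    e.symm_apply_apply]
  exact (pairing_mulVec x v w).symm

/-- Right multiplication by a square matrix on row vectors, as an `ℝ`-linear map. -/
def rowAction (x : Matrix ι ι F) : Module.End ℝ (ι → F) where
  toFun v := v ᵥ* x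
  map_add' v w := Matrix.add_vecMul x v w
  map_smul' c v := Matrix.smul_vecMul c v x

/-- Entrywise conjugation of vectors carries the action of `x` on rows to the action of `star x` on
columns. -/
theorem det_rowAction (x : Matrix ι ι F) : LinearMap.det (rowAction x) = realDet x := by
  rw [← realDet_star, realDet_apply, ← LinearMap.det_conj (realAction (star x)) (starVec F ι)]
  congr 1
  refine LinearMap.ext fun v => ?_
  change v ᵥ* x = star (xᴴ *ᵥ star v)
  rw [star_mulVec, conjTranspose_conjTranspose, star_star]

theorem realDet_submatrix (e : κ ≃ ι) (x : Matrix ι ι F) :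
    realDet (x.submatrix e e) = realDet x := by
  rw [realDet_apply, realDet_apply,
    ← LinearMap.det_conj (realAction x) (LinearEquiv.funCongrLeft ℝ F e)]
  congr 1
  refine LinearMap.ext fun v => ?_
  change x.submatrix e e *ᵥ v = (x *ᵥ (v ∘ e.symm)) ∘ e
  rw [Matrix.submatrix_mulVec_equiv]

theorem isUnit_of_realDet_ne_zero {x : Matrix ι ι F} (h : realDet x ≠ 0) : IsUnit x := by
  have hu : IsUnit (realAction x) := by
    rw [LinearMap.isUnit_iff_isUnit_det]
    exact h.isUnit
  have hs : Function.Surjective (realAction x) := by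
    rw [← LinearMap.range_eq_top]
    exact (LinearMap.isUnit_iff_range_eq_top _).1 hu
  choose g hg using fun i => hs (Pi.single i 1)
  have hmul : x * Matrix.of (fun i j => g j i) = 1 := by
    ext i j
    have := congrFun (hg j) i
    simp only [realAction_apply, mulVec, dotProduct] at this
    simp [Matrix.mul_apply, this, Matrix.one_apply, Pi.single_apply]
  exact ⟨⟨x, _, hmul, mul_eq_one_comm.1 hmul⟩, rfl⟩

theorem realDet_ne_zero (x : (Matrix ι ι F)ˣ) : realDet (x : Matrix ι ι F) ≠ 0 :=
  (x.isUnit.map realDet).ne_zero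

theorem realDet_smul_one (r : ℝ) :
    realDet (r • (1 : Matrix ι ι F)) = r ^ (F.d * Fintype.card ι) := by
  have : realAction (r • (1 : Matrix ι ι F)) = r • (LinearMap.id : Module.End ℝ (ι → F)) := by
    refine LinearMap.ext fun v => ?_
    simp [Matrix.smul_mulVec]
  rw [realDet_apply, this, LinearMap.det_smul, LinearMap.det_id, mul_one, Module.finrank_pi_fintype,
    Finset.sum_const, Finset.card_univ, smul_eq_mul, mul_comm, ScalarField.d]

theorem realDet_fromBlocks_diagonal (a : Matrix ι ι F) (b : Matrix κ κ F) :
    realDet (fromBlocks a 0 0 b) = realDet a * realDet b := by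
  rw [realDet_apply, realDet_apply, realDet_apply, ← LinearMap.det_prodMap,
    ← LinearMap.det_conj _ (LinearEquiv.sumArrowLequivProdArrow ι κ ℝ F)]
  congr 1
  apply LinearMap.ext
  rintro ⟨v, w⟩
  have : (LinearEquiv.sumArrowLequivProdArrow ι κ ℝ F).symm (v, w) = Sum.elim v w := rfl
  rw [LinearMap.comp_apply, LinearMap.comp_apply, LinearEquiv.coe_coe, LinearEquiv.coe_coe, this,
    realAction_apply, fromBlocks_mulVec]
  refine Prod.ext ?_ ?_ <;> funext i <;> simp [LinearEquiv.sumArrowLequivProdArrow]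

/-- With `u` the unipotent matrix and `g = diag(2, 1)`, `u² g = g u`. Determinants commute, so `det
u² = det u`, and `det u` is nonzero. -/
theorem realDet_unipotent (X : Matrix ι κ F) :
    realDet (fromBlocks 1 X 0 1 : Matrix (ι ⊕ κ) (ι ⊕ κ) F) = 1 := by
  have h : (fromBlocks 1 X 0 1 : Matrix (ι ⊕ κ) (ι ⊕ κ) F) * fromBlocks 1 X 0 1
      * fromBlocks ((2 : ℝ) • 1) 0 0 1
      = fromBlocks ((2 : ℝ) • 1) 0 0 1 * fromBlocks 1 X 0 1 := by
    simp [fromBlocks_multiply, ← two_smul ℝ]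
  have h' := congrArg realDet h
  have h2 : realDet (fromBlocks ((2 : ℝ) • 1) 0 0 1 : Matrix (ι ⊕ κ) (ι ⊕ κ) F) ≠ 0 := by
    rw [realDet_fromBlocks_diagonal, realDet_smul_one]
    simp
  have h1 : realDet (fromBlocks 1 X 0 1 : Matrix (ι ⊕ κ) (ι ⊕ κ) F) ≠ 0 := by
    refine realDet_ne_zero ⟨fromBlocks 1 X 0 1, fromBlocks 1 (-X) 0 1, ?_, ?_⟩ <;>
      simp [fromBlocks_multiply]
  rw [map_mul, map_mul, map_mul, mul_comm (realDet (fromBlocks ((2 : ℝ) • 1) 0 0 1))] at h'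
  have h'' := mul_right_cancel₀ h2 h'
  exact mul_left_cancel₀ h1 (by rw [h'', mul_one])

theorem realDet_fromBlocks (a : Matrix ι ι F) (X : Matrix ι κ F) (b : Matrix κ κ F) :
    realDet (fromBlocks a X 0 b) = realDet a * realDet b := by
  have h : fromBlocks a X 0 b = fromBlocks 1 0 0 b * fromBlocks 1 X 0 1 * fromBlocks a 0 0 1 := by
    simp [fromBlocks_multiply]
  rw [h, map_mul, map_mul, realDet_unipotent, realDet_fromBlocks_diagonal,
    realDet_fromBlocks_diagonal, map_one, map_one]
  ring

theorem abs_realDet_of_unitary {U : Matrix ι ι F} (hU : star U * U = 1) : |realDet U| = 1 := by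
  have h := congrArg realDet hU
  rw [map_mul, realDet_star, map_one, ← sq] at h
  rw [← sq_abs] at h
  nlinarith [abs_nonneg (realDet U)]

theorem continuous_realDet : Continuous (realDet : Matrix ι ι F → ℝ) := by
  let T : Matrix ι ι F →ₗ[ℝ] ((ι → F) →L[ℝ] (ι → F)) :=
    { toFun := fun x => LinearMap.toContinuousLinearMap (realAction x)
      map_add' := fun x y => by
        ext1 v
        exact Matrix.add_mulVec x y v
      map_smul' := fun c x => by
        ext1 v
        exact Matrix.smul_mulVec c x v }
  have hT : Continuous T := T.continuous_of_finiteDimensional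
  exact ContinuousLinearMap.continuous_det.comp hT

end RealDet

/-! ### Unitary matrices -/

section HilbertSchmidt

variable {F : ScalarField} {ι ι' κ : Type} [Fintype ι] [Fintype ι'] [Fintype κ]

/-- The square of the Hilbert-Schmidt norm. -/
def normSq (Z : ι → κ → F) : ℝ := ∑ i, ∑ j, ‖Z i j‖ ^ 2

theorem algebraMap_normSq (Z : Matrix ι κ F) : algebraMap ℝ F (normSq Z) = (Zᴴ * Z).trace := by
  simp only [normSq, trace, diag, Matrix.mul_apply, conjTranspose_apply, star_mul_self_eq,
    map_sum]
  exact Finset.sum_comm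

theorem normSq_congr {Z : Matrix ι κ F} {Z' : Matrix ι' κ F}
    (h : Zᴴ * Z = Z'ᴴ * Z') : normSq Z = normSq Z' := by
  apply (algebraMap ℝ F).injective
  rw [algebraMap_normSq, algebraMap_normSq, h]

theorem normSq_conjTranspose (Z : Matrix ι κ F) : normSq Zᴴ = normSq Z := by
  simp only [normSq, conjTranspose_apply, norm_star]
  exact Finset.sum_comm

theorem normSq_eq_zero_iff {Z : ι → κ → F} : normSq Z = 0 ↔ Z = 0 := by
  constructor
  · intro h
    funext i j
    rw [normSq, Finset.sum_eq_zero_iff_of_nonneg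
      (fun _ _ => Finset.sum_nonneg fun _ _ => by positivity)] at h
    have h' := h i (Finset.mem_univ i)
    rw [Finset.sum_eq_zero_iff_of_nonneg (fun _ _ => by positivity)] at h'
    simpa using h' j (Finset.mem_univ j)
  · rintro rfl
    simp [normSq]

end HilbertSchmidt

/-! ### Unitary matrices that move one isometry to another -/

section Unitary

variable {F : ScalarField} {ι κ : Type} [Fintype ι] [DecidableEq ι] [Fintype κ] [DecidableEq κ]

/-- A block Householder reflection: with `W = V - E`, the matrix `U = 1 - W C Wᴴ` works. Since `Wᴴ V
= 1 - Eᴴ V` is inverse to `C`, `U V = V - W = E`; unitarity comes from `Wᴴ W = A + Aᴴ` with `A = 1 -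
Eᴴ V`. The argument is valid over a skew field. -/
theorem exists_unitary_of_inverse {V E : Matrix ι κ F} (hV : Vᴴ * V = 1) (hE : Eᴴ * E = 1)
    {C : Matrix κ κ F} (hC : C * (1 - Eᴴ * V) = 1) :
    ∃ U : Matrix ι ι F, star U * U = 1 ∧ U * V = E := by
  set A := 1 - Eᴴ * V with hA
  set W := V - E with hW
  have hC' : A * C = 1 := mul_eq_one_comm.1 hC
  have hWV : Wᴴ * V = A := by rw [hW, conjTranspose_sub, Matrix.sub_mul, hV]
  have hWW : Wᴴ * W = A + Aᴴ := by
    rw [hW, hA]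
    simp only [conjTranspose_sub, conjTranspose_mul, conjTranspose_conjTranspose,
      conjTranspose_one, Matrix.sub_mul, Matrix.mul_sub, hV, hE]
    abel
  refine ⟨1 - W * C * Wᴴ, ?_, ?_⟩
  · have h1 : Cᴴ * (A + Aᴴ) * C = Cᴴ + C := by
      rw [Matrix.mul_add, Matrix.add_mul, Matrix.mul_assoc, hC', Matrix.mul_one,
        ← conjTranspose_mul, hC', conjTranspose_one, Matrix.one_mul]
    have h2 : (W * Cᴴ * Wᴴ) * (W * C * Wᴴ) = W * Cᴴ * Wᴴ + W * C * Wᴴ := by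
      calc (W * Cᴴ * Wᴴ) * (W * C * Wᴴ) = W * (Cᴴ * (Wᴴ * W) * C) * Wᴴ := by
            simp only [Matrix.mul_assoc]
        _ = _ := by rw [hWW, h1, Matrix.mul_add, Matrix.add_mul]
    rw [star_eq_conjTranspose]
    simp only [conjTranspose_sub, conjTranspose_one, conjTranspose_mul,
      conjTranspose_conjTranspose, ← Matrix.mul_assoc W, Matrix.sub_mul, Matrix.mul_sub,
      Matrix.one_mul, Matrix.mul_one, h2]
    abel
  · rw [Matrix.sub_mul, Matrix.one_mul, Matrix.mul_assoc, Matrix.mul_assoc, hWV, hC,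
      Matrix.mul_one, hW]
    abel

theorem normSq_unitary_mul {κ : Type} [Fintype κ] {U : Matrix ι ι F} (hU : star U * U = 1)
    (Z : Matrix ι κ F) :
    normSq (U * Z) = normSq Z := by
  apply normSq_congr
  rw [conjTranspose_mul, Matrix.mul_assoc, ← Matrix.mul_assoc Uᴴ, ← star_eq_conjTranspose U, hU,
    Matrix.one_mul]

theorem normSq_mul_unitary {ι : Type} [Fintype ι] {U : Matrix κ κ F} (hU : star U * U = 1)
    (Z : Matrix ι κ F) :
    normSq (Z * U) = normSq Z := by
  rw [← normSq_conjTranspose, conjTranspose_mul, ← star_eq_conjTranspose U, normSq_unitary_mul,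
    normSq_conjTranspose]
  rw [star_star]
  exact mul_eq_one_comm.1 hU

theorem exists_unitary_mulVec (i₀ : ι) {v : ι → F} (hv : v ≠ 0) :
    ∃ U : Matrix ι ι F, star U * U = 1 ∧
      U *ᵥ v = Pi.single i₀ (algebraMap ℝ F (√(∑ i, ‖v i‖ ^ 2))) := by
  set r := √(∑ i, ‖v i‖ ^ 2) with hr
  have hpos : 0 < ∑ i, ‖v i‖ ^ 2 := by
    obtain ⟨i, hi⟩ := Function.ne_iff.1 hv
    have : 0 < ‖v i‖ ^ 2 := pow_pos (norm_pos_iff.2 hi) 2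
    exact this.trans_le (Finset.single_le_sum (f := fun i => ‖v i‖ ^ 2)
      (fun _ _ => by positivity) (Finset.mem_univ i))
  have hr0 : 0 < r := Real.sqrt_pos.2 hpos
  have hrr : r ^ 2 = ∑ i, ‖v i‖ ^ 2 := Real.sq_sqrt hpos.le
  let V : Matrix ι Unit F := Matrix.of fun i _ => r⁻¹ • v i
  let E : Matrix ι Unit F := Matrix.of fun i _ => Pi.single (M := fun _ => F) i₀ 1 i
  have hV : Vᴴ * V = 1 := by
    ext i j
    simp only [V, Matrix.mul_apply, conjTranspose_apply, of_apply, star_mul_self_eq, ← map_sum,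
      norm_smul, mul_pow, ← Finset.mul_sum, ← hrr, norm_inv, Real.norm_eq_abs]
    simp [hr0.ne', abs_of_pos hr0]
  have hE : Eᴴ * E = 1 := by
    ext i j
    simp [E, Matrix.mul_apply, Pi.single_apply]
  obtain ⟨U, hU, hUV⟩ : ∃ U : Matrix ι ι F, star U * U = 1 ∧ U * V = E := by
    -- The reflection degenerates only if the unit vectors have inner product one. Then they
    -- coincide (equality in Cauchy-Schwarz) and `U = 1` serves.
    by_cases h : (1 - Eᴴ * V : Matrix Unit Unit F) () () = 0
    · have hEV : Eᴴ * V = 1 := by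
        ext i j
        exact (sub_eq_zero.1 h).symm
      have hVE : Vᴴ * E = 1 := by
        rw [← conjTranspose_one, ← hEV, conjTranspose_mul, conjTranspose_conjTranspose]
      have h0 : (V - E)ᴴ * (V - E) = 0 := by
        rw [conjTranspose_sub, Matrix.sub_mul, Matrix.mul_sub, Matrix.mul_sub, hV, hE, hEV, hVE]
        simp
      have h1 : normSq (V - E) = 0 := by
        apply (algebraMap ℝ F).injective
        rw [algebraMap_normSq, h0]
        simp
      have h2 : V = E := sub_eq_zero.1 (normSq_eq_zero_iff.1 h1)
      exact ⟨1, by simp, by simpa using h2⟩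
    · refine exists_unitary_of_inverse hV hE (C := Matrix.of fun _ _ => ((1 - Eᴴ * V : Matrix Unit Unit F) () ())⁻¹) ?_
      ext i j
      simp [Matrix.mul_apply] at h ⊢
      exact inv_mul_cancel₀ h
  refine ⟨U, hU, ?_⟩
  funext i
  have h := congrFun (congrFun hUV i) ()
  simp only [V, E, Matrix.mul_apply, of_apply, mul_smul_comm, ← Finset.smul_sum] at h
  rw [inv_smul_eq_iff₀ hr0.ne'] at h
  rw [mulVec, dotProduct, h]
  by_cases hi : i = i₀
  · subst hi
    simp [Algebra.algebraMap_eq_smul_one]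
  · simp [hi]

theorem exists_unitary_vecMul (i₀ : ι) {v : ι → F} (hv : v ≠ 0) :
    ∃ U : Matrix ι ι F, star U * U = 1 ∧
      v ᵥ* U = Pi.single i₀ (algebraMap ℝ F (√(∑ i, ‖v i‖ ^ 2))) := by
  obtain ⟨U, hU, h⟩ := exists_unitary_mulVec i₀ (star_ne_zero.2 hv)
  refine ⟨star U, by rw [star_star]; exact mul_eq_one_comm.1 hU, ?_⟩
  have h' := congrArg star h
  rw [star_mulVec, star_star] at h'
  rw [star_eq_conjTranspose, h', ← Pi.single_star, star_algebraMap]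
  simp

end Unitary

/-! ### Matrices of positive determinant and the `QR` decomposition -/

section PosDet

variable {F : ScalarField} {ι κ : Type} [Fintype ι] [DecidableEq ι] [Fintype κ] [DecidableEq κ]

/-- The (Dieudonné) determinant is a positive real number. -/
def PosDet (F : ScalarField) {ι : Type} [Fintype ι] [DecidableEq ι] : Matrix ι ι F → Prop :=
  match F with
  | .real => fun x : Matrix ι ι ℝ => 0 < x.det
  | .complex => fun x : Matrix ι ι ℂ => ∃ r : ℝ, 0 < r ∧ x.det = r
  | .quaternion => fun x => 0 < realDet x

theorem PosDet.submatrix {x : Matrix ι ι F} (h : PosDet F x) (e : κ ≃ ι) :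
    PosDet F (x.submatrix e e) := by
  match F, x, h with
  | .real, x, h => exact h.trans_eq (Matrix.det_submatrix_equiv_self (R := ℝ) e x).symm
  | .complex, x, h =>
    obtain ⟨r, hr, hx⟩ := h
    exact ⟨r, hr, (Matrix.det_submatrix_equiv_self (R := ℂ) e x).trans hx⟩
  | .quaternion, x, h => exact h.trans_eq (realDet_submatrix e x).symm

theorem PosDet.fromBlocks {a : Matrix ι ι F} {b : Matrix κ κ F} (ha : PosDet F a)
    (hb : PosDet F b) (X : Matrix ι κ F) : PosDet F (fromBlocks a X 0 b) := by
  match F, a, b, X, ha, hb with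
  | .real, a, b, X, ha, hb =>
    exact (mul_pos ha hb).trans_eq (Matrix.det_fromBlocks_zero₂₁ (R := ℝ) a X b).symm
  | .complex, a, b, X, ha, hb =>
    obtain ⟨r, hr, hx⟩ := ha
    obtain ⟨s, hs, hy⟩ := hb
    refine ⟨r * s, mul_pos hr hs, (Matrix.det_fromBlocks_zero₂₁ (R := ℂ) a X b).trans ?_⟩
    rw [hx, hy, Complex.ofReal_mul]
  | .quaternion, a, b, X, ha, hb => 
    exact (mul_pos ha hb).trans_eq (realDet_fromBlocks a X b).symm

theorem posDet_smul_one {r : ℝ} (hr : 0 < r) : PosDet F (r • (1 : Matrix ι ι F)) := by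
  have hR : 0 < (r • (1 : Matrix ι ι ℝ)).det := by
    rw [Matrix.det_smul, Matrix.det_one, mul_one]
    positivity
  have hC : (r • (1 : Matrix ι ι ℂ)).det = (r ^ Fintype.card ι : ℝ) := by
    rw [Matrix.det_smul_of_tower, Matrix.det_one]
    simp
  match F with
  | .real => exact hR
  | .complex => exact ⟨_, pow_pos hr _, hC⟩
  | .quaternion =>
    change 0 < realDet _
    rw [realDet_smul_one]
    positivity

theorem posDet_of_isEmpty [IsEmpty ι] (x : Matrix ι ι F) : PosDet F x := by
  rw [Subsingleton.elim x ((1 : ℝ) • 1)]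
  exact posDet_smul_one one_pos

/-- The determinant of a unitary matrix has absolute value one. As `det x = 1`, the determinant of
`U` is that of `U x`, hence positive, hence one. -/
theorem mem_specialLinear_of_posDet {U x : (Matrix ι ι F)ˣ}
    (hU : star U.val * U.val = 1) (hx : x ∈ specialLinear F ι)
    (h : PosDet F (U.val * x.val)) : U ∈ specialLinear F ι := by
  have hR : ∀ U x : Matrix ι ι ℝ, star U * U = 1 → x.det = 1 → 0 < (U * x).det → U.det = 1 := by
    intro U x hU hx h
    rw [det_mul, hx, mul_one] at h
    have h' := congrArg det hU
    rw [det_mul, star_eq_conjTranspose, det_conjTranspose, star_trivial, det_one] at h'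
    nlinarith
  have hC : ∀ U x : Matrix ι ι ℂ, star U * U = 1 → x.det = 1 →
      (∃ r : ℝ, 0 < r ∧ (U * x).det = r) → U.det = 1 := by
    rintro U x hU hx ⟨r, hr, h⟩
    rw [det_mul, hx, mul_one] at h
    have h' := congrArg det hU
    rw [det_mul, star_eq_conjTranspose, det_conjTranspose, det_one, h, Complex.star_def,
      Complex.conj_ofReal] at h'
    have h'' : r * r = 1 := by exact_mod_cast h'
    have : r = 1 := by nlinarith
    rw [h, this, Complex.ofReal_one]
  match F, U, x, hU, hx, h with
  | .real, U, x, hU, hx, h => exact hR U.val x.val hU hx h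
  | .complex, U, x, hU, hx, h => exact hC U.val x.val hU hx h
  | .quaternion, U, x, hU, hx, h =>
    change realDet U.val = 1
    change realDet x.val = 1 at hx
    change 0 < realDet (U.val * x.val) at h
    rw [map_mul, hx, mul_one] at h
    rw [← abs_realDet_of_unitary hU, abs_of_pos h]

/-- The first index and the remaining ones. -/
def headTail (n : ℕ) : Unit ⊕ Fin n ≃ Fin (n + 1) where
  toFun := Sum.elim (fun _ => 0) Fin.succ
  invFun := Fin.cases (Sum.inl ()) Sum.inr
  left_inv := by rintro (_ | i) <;> rfl
  right_inv := by intro i; refine Fin.cases ?_ (fun i => ?_) i <;> rfl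

@[simp] theorem headTail_symm_zero (n : ℕ) : (headTail n).symm 0 = Sum.inl () := rfl

@[simp] theorem headTail_symm_succ (n : ℕ) (i : Fin n) :
    (headTail n).symm i.succ = Sum.inr i := rfl

/-- QR decomposition by rotating one column after another onto a positive multiple of a basis
vector. Positivity of the diagonal is recorded because it later places the unitary factor in `SL`.
-/
theorem exists_unitary_mul_upperTriangular (n : ℕ) (x : Matrix (Fin n) (Fin n) F)
    (hx : realDet x ≠ 0) : ∃ U : Matrix (Fin n) (Fin n) F, star U * U = 1 ∧ PosDet F (U * x) ∧
      ∀ i j, j < i → (U * x) i j = 0 := by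
  induction n with
  | zero => exact ⟨1, by simp, posDet_of_isEmpty _, fun i => i.elim0⟩
  | succ n ih =>
    let e := headTail n
    have hcol : x.col 0 ≠ 0 := by
      obtain ⟨u, rfl⟩ := isUnit_of_realDet_ne_zero hx
      intro h
      have h1 : u.val *ᵥ Pi.single 0 1 = 0 := by rw [mulVec_single_one, h]
      have h2 := congrArg (fun v => (u⁻¹).val *ᵥ v) h1
      simp only [mulVec_mulVec, Units.inv_mul, one_mulVec, mulVec_zero] at h2
      simpa using congrFun h2 0
    obtain ⟨U₁, hU₁, h₁⟩ := exists_unitary_mulVec 0 hcol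
    set r := √(∑ i, ‖x.col 0 i‖ ^ 2)
    have hy : ∀ i, (U₁ * x) i 0 = (Pi.single 0 (algebraMap ℝ F r) : Fin (n + 1) → F) i :=
      fun i => congrFun h₁ i
    let y' : Matrix (Fin n) (Fin n) F := (U₁ * x).submatrix Fin.succ Fin.succ
    let X : Matrix Unit (Fin n) F := (U₁ * x).submatrix (fun _ => 0) Fin.succ
    have hblock : U₁ * x = (fromBlocks (r • 1) X 0 y').submatrix e.symm e.symm := by
      ext i j
      refine Fin.cases ?_ (fun i => ?_) i <;> refine Fin.cases ?_ (fun j => ?_) j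
      · simp [hy, e, Algebra.algebraMap_eq_smul_one]
      · simp [e, X]
      · simp [hy, e]
      · simp [e, y']
    have hdet : realDet (U₁ * x) ≠ 0 := by
      rw [map_mul]
      refine mul_ne_zero (fun h => ?_) hx
      have := abs_realDet_of_unitary hU₁
      simp [h] at this
    have hdet' : realDet (r • (1 : Matrix Unit Unit F)) * realDet y' ≠ 0 := by
      rwa [← realDet_fromBlocks _ X, ← realDet_submatrix e.symm, ← hblock]
    have hr : 0 < r := by
      refine (Real.sqrt_nonneg _).lt_of_ne' fun h => hdet' ?_
      have hd : F.d ≠ 0 := Module.finrank_pos.ne'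
      rw [realDet_smul_one, show r = 0 from h, zero_pow (by simpa using hd), zero_mul]
    obtain ⟨U', hU', hpos, htri⟩ := ih y' (right_ne_zero_of_mul hdet')
    have hU'' : star ((fromBlocks 1 0 0 U' : Matrix (Unit ⊕ Fin n) (Unit ⊕ Fin n) F).submatrix
        e.symm e.symm) * (fromBlocks 1 0 0 U').submatrix e.symm e.symm = 1 := by
      rw [star_eq_conjTranspose, conjTranspose_submatrix, submatrix_mul_equiv,
        fromBlocks_conjTranspose, fromBlocks_multiply, ← star_eq_conjTranspose U', hU']
      simp
    have hprod : (fromBlocks 1 0 0 U').submatrix e.symm e.symm * U₁ * x =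
        (fromBlocks (r • 1) X 0 (U' * y')).submatrix e.symm e.symm := by
      rw [Matrix.mul_assoc, hblock, submatrix_mul_equiv, fromBlocks_multiply]
      simp
    refine ⟨(fromBlocks 1 0 0 U').submatrix e.symm e.symm * U₁, ?_, ?_, ?_⟩
    · rw [star_mul, Matrix.mul_assoc, ← Matrix.mul_assoc _ _ U₁, hU'', Matrix.one_mul, hU₁]
    · rw [hprod]
      exact ((posDet_smul_one hr).fromBlocks hpos X).submatrix e.symm
    · rw [hprod]
      intro i j
      refine Fin.cases ?_ (fun i => ?_) i <;> refine Fin.cases ?_ (fun j => ?_) j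
      · simp
      · simp
      · simp [e]
      · intro h
        simpa [e] using htri i j (by simpa using h)

end PosDet

/-! ### The decompositions `G = K M A N` and `N̄ M A N` -/

section Decompositions

variable {F : ScalarField} {p q : ℕ}

theorem G.mat_mul (x y : G F p q) : (x * y).mat = x.mat * y.mat := rfl

theorem G.mat_inv_mul (x : G F p q) : x⁻¹.mat * x.mat = 1 := (x : (Mat F p q)ˣ).inv_mul

theorem G.realDet_ne_zero (x : G F p q) : realDet x.mat ≠ 0 :=
  CosLambda.realDet_ne_zero (x : (Mat F p q)ˣ)

theorem nMat_mul (X Y : Matrix (Fin p) (Fin q) F) : nMat X * nMat Y = nMat (X + Y) := by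
  simp [nMat, fromBlocks_multiply, add_comm]

theorem nMat_zero : nMat (0 : Matrix (Fin p) (Fin q) F) = 1 := by
  simp [nMat]

/-- `n(X)` as an invertible matrix. -/
def nUnit (X : Matrix (Fin p) (Fin q) F) : (Mat F p q)ˣ where
  val := nMat X
  inv := nMat (-X)
  val_inv := by rw [nMat_mul, add_neg_cancel, nMat_zero]
  inv_val := by rw [nMat_mul, neg_add_cancel, nMat_zero]

theorem nUnit_mem (X : Matrix (Fin p) (Fin q) F) : nUnit X ∈ specialLinear F (Fin p ⊕ Fin q) := by
  let g : (Mat F p q)ˣ :=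
    { val := fromBlocks ((2 : ℝ) • 1) 0 0 1
      inv := fromBlocks ((2⁻¹ : ℝ) • 1) 0 0 1
      val_inv := by simp [fromBlocks_multiply]
      inv_val := by simp [fromBlocks_multiply] }
  have h : nUnit X = g * nUnit X * g⁻¹ * (nUnit X)⁻¹ := by
    rw [eq_mul_inv_iff_mul_eq, eq_mul_inv_iff_mul_eq]
    ext1
    change nMat X * nMat X * fromBlocks ((2 : ℝ) • 1) 0 0 1
      = fromBlocks ((2 : ℝ) • 1) 0 0 1 * nMat X
    simp [nMat, fromBlocks_multiply, ← two_smul ℝ]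
  rw [h]
  exact commutator_mem_specialLinear F _ _

theorem aMat_mul (s t : ℝ) : aMat F p q s * aMat F p q t = aMat F p q (s + t) := by
  simp only [aMat_eq, fromBlocks_multiply, Matrix.mul_zero, Matrix.zero_mul, add_zero, zero_add,
    smul_mul_smul_comm, Matrix.mul_one, ← Real.exp_add, ← add_mul]

theorem aMat_zero : aMat F p q 0 = 1 := by
  simp [aMat_eq]

/-- `exp(t H_o)` as an invertible matrix. -/
def aUnit (F : ScalarField) (p q : ℕ) (t : ℝ) : (Mat F p q)ˣ where
  val := aMat F p q t
  inv := aMat F p q (-t)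
  val_inv := by rw [aMat_mul, add_neg_cancel, aMat_zero]
  inv_val := by rw [aMat_mul, neg_add_cancel, aMat_zero]

theorem mem_specialLinear_of_diagonal {r s : ℝ} (h : r ^ p * s ^ q = 1) {u : (Mat F p q)ˣ}
    (hu : u.val = fromBlocks (r • 1) 0 0 (s • 1)) : u ∈ specialLinear F (Fin p ⊕ Fin q) := by
  have hR : (fromBlocks (r • 1) 0 0 (s • 1) : Matrix (Fin p ⊕ Fin q) (Fin p ⊕ Fin q) ℝ).det = 1 := by
    rw [det_fromBlocks_zero₂₁, det_smul, det_smul]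
    simpa using h
  have hC : (fromBlocks (r • 1) 0 0 (s • 1) : Matrix (Fin p ⊕ Fin q) (Fin p ⊕ Fin q) ℂ).det = 1 := by
    rw [det_fromBlocks_zero₂₁, det_smul_of_tower, det_smul_of_tower]
    simpa [← Complex.ofReal_pow, ← Complex.ofReal_mul] using h
  match F, u, hu with
  | .real, u, hu => exact (congrArg (Matrix.det (R := ℝ)) hu).trans hR
  | .complex, u, hu => exact (congrArg (Matrix.det (R := ℂ)) hu).trans hC
  | .quaternion, u, hu =>
    change realDet u.val = 1
    rw [hu, realDet_fromBlocks_diagonal, realDet_smul_one, realDet_smul_one, Fintype.card_fin,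
      Fintype.card_fin, mul_comm _ p, mul_comm _ q, pow_mul, pow_mul, ← mul_pow, h, one_pow]

theorem aUnit_mem (t : ℝ) : aUnit F p q t ∈ specialLinear F (Fin p ⊕ Fin q) := by
  refine mem_specialLinear_of_diagonal ?_ (aMat_eq F p q t)
  rw [← Real.exp_nat_mul, ← Real.exp_nat_mul, ← Real.exp_add, Real.exp_eq_one_iff]
  ring

variable (F p q) in
/-- The exponent `dpq/(n+1)`: on `exp (t H_o)`, the real determinant of the upper left block is
`exp (t * dpq/(n+1))`. -/
def blockWeight : ℝ := F.d * p * q / (p + q)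

theorem d_pos (F : ScalarField) : 0 < F.d := Module.finrank_pos

theorem blockWeight_pos (hp : 1 ≤ p) (hq : 1 ≤ q) : 0 < blockWeight F p q := by
  have h := d_pos F
  unfold blockWeight
  positivity

theorem exists_levi {y : G F p q} (hp : 1 ≤ p) (hq : 1 ≤ q) {a : Matrix (Fin p) (Fin p) F}
    {X : Matrix (Fin p) (Fin q) F} {b : Matrix (Fin q) (Fin q) F}
    (hy : y.mat = fromBlocks a X 0 b) :
    ∃ (t : ℝ) (m : G F p q) (X' : Matrix (Fin p) (Fin q) F), m ∈ M F p q ∧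
      y.mat = m.mat * aMat F p q t * nMat X' := by
  have ha : realDet a ≠ 0 := by
    have h := y.realDet_ne_zero
    rw [hy, realDet_fromBlocks] at h
    exact left_ne_zero_of_mul h
  obtain ⟨u, rfl⟩ := isUnit_of_realDet_ne_zero ha
  -- This `t` makes `exp(t H_o)` absorb exactly `|det_ℝ|` of the upper left block, so that the
  -- remaining factor lies in `M`.
  set t := Real.log |realDet u.val| / blockWeight F p q with ht
  have htw : t * blockWeight F p q = Real.log |realDet u.val| :=
    div_mul_cancel₀ _ (blockWeight_pos hp hq).ne'
  let m : G F p q := y * ⟨nUnit (u⁻¹.val * X), nUnit_mem _⟩⁻¹ * ⟨aUnit F p q t, aUnit_mem t⟩⁻¹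
  have hm : m.mat = y.mat * nMat (-(u⁻¹.val * X)) * aMat F p q (-t) := rfl
  refine ⟨t, m, u⁻¹.val * X, ⟨Real.exp (-t * ((q : ℝ) / ((p : ℝ) + q))) • u.val,
    Real.exp (-t * (-((p : ℝ) / ((p : ℝ) + q)))) • b, ?_, ?_⟩, ?_⟩
  · rw [hm, hy, aMat_eq, nMat, fromBlocks_multiply, fromBlocks_multiply]
    simp [← Matrix.mul_assoc]
  · have h : Real.exp (-t * ((q : ℝ) / ((p : ℝ) + q))) • u.val =
        (Real.exp (-t * ((q : ℝ) / ((p : ℝ) + q))) • 1) * u.val := by simp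
    rw [h, map_mul, realDet_smul_one, ← Real.exp_nat_mul, abs_mul, Real.abs_exp,
      ← Real.exp_log (abs_pos.2 ha), ← htw, ← Real.exp_add, Real.exp_eq_one_iff,
      Fintype.card_fin, blockWeight]
    push_cast
    ring
  · rw [hm]
    simp only [Matrix.mul_assoc]
    rw [← Matrix.mul_assoc (aMat F p q (-t)), aMat_mul, neg_add_cancel, aMat_zero, Matrix.one_mul,
      nMat_mul, neg_add_cancel, nMat_zero, Matrix.mul_one]

theorem exists_isAlpha (hp : 1 ≤ p) (hq : 1 ≤ q) {x : G F p q}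
    (hx : realDet x.mat.toBlocks₁₁ ≠ 0) : ∃ t, IsAlpha x t := by
  obtain ⟨u, hu⟩ := isUnit_of_realDet_ne_zero hx
  -- Block Gaussian elimination: `n̄(-Y)` clears the lower left block.
  set Y := x.mat.toBlocks₂₁ * u⁻¹.val
  have hy : (nbar (-Y) * x).mat = fromBlocks u.val x.mat.toBlocks₁₂ 0
      (-Y * x.mat.toBlocks₁₂ + x.mat.toBlocks₂₂) := by
    change nbarMat (-Y) * x.mat = _
    conv_lhs => rw [← fromBlocks_toBlocks x.mat, nbarMat, fromBlocks_multiply, ← hu]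
    simp [Y, Matrix.mul_assoc]
  obtain ⟨t, m, X, hm, h⟩ := exists_levi hp hq hy
  refine ⟨t, Y, m, X, hm, ?_⟩
  rw [Matrix.mul_assoc, Matrix.mul_assoc, ← Matrix.mul_assoc m.mat, ← h, G.mat_mul]
  change _ = nbarMat Y * (nbarMat (-Y) * x.mat)
  rw [← Matrix.mul_assoc, nbarMat_mul, add_neg_cancel, nbarMat_zero, Matrix.one_mul]

theorem exists_isIwasawa (hp : 1 ≤ p) (hq : 1 ≤ q) (x : G F p q) : ∃ t, IsIwasawa x t := by
  let e : Fin p ⊕ Fin q ≃ Fin (p + q) := finSumFinEquiv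
  obtain ⟨U', hU', hpos', htri⟩ := exists_unitary_mul_upperTriangular (p + q)
    (x.mat.submatrix e.symm e.symm) (by rw [realDet_submatrix]; exact x.realDet_ne_zero)
  set U : Mat F p q := U'.submatrix e e with hUdef
  have hU : star U * U = 1 := by
    rw [star_eq_conjTranspose, hUdef, conjTranspose_submatrix, submatrix_mul_equiv,
      ← star_eq_conjTranspose, hU', submatrix_one_equiv]
  have hUx : U * x.mat = (U' * x.mat.submatrix e.symm e.symm).submatrix e e := by
    rw [← submatrix_mul_equiv _ _ e e e, submatrix_submatrix]
    simp [hUdef]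
  have hpos : PosDet F (U * x.mat) := by
    rw [hUx]
    exact hpos'.submatrix e
  let u : (Mat F p q)ˣ := ⟨U, star U, mul_eq_one_comm.1 hU, hU⟩
  let k : G F p q := ⟨u, mem_specialLinear_of_posDet (U := u) (x := x.1) hU x.2 hpos⟩
  have hk : k ∈ K F p q := hU
  have hkx : (k * x).mat = fromBlocks (U * x.mat).toBlocks₁₁ (U * x.mat).toBlocks₁₂ 0
      (U * x.mat).toBlocks₂₂ := by
    change U * x.mat = _
    conv_lhs => rw [← fromBlocks_toBlocks (U * x.mat)]
    congr 1
    ext i j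
    rw [hUx]
    -- `finSumFinEquiv` places `Fin p` before `Fin q`, so the lower left block lies strictly below
    -- the diagonal.
    refine htri _ _ ?_
    simp only [e, finSumFinEquiv_apply_left, finSumFinEquiv_apply_right]
    exact Fin.lt_def.2 (by simp; omega)
  obtain ⟨t, m, X, hm, h⟩ := exists_levi hp hq hkx
  refine ⟨t, k⁻¹, m, X, inv_mem hk, hm, ?_⟩
  rw [Matrix.mul_assoc, Matrix.mul_assoc, ← Matrix.mul_assoc m.mat, ← h, G.mat_mul,
    ← Matrix.mul_assoc, G.mat_inv_mul, Matrix.one_mul]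

/-- The first `p` columns. -/
def frame (x : Mat F p q) : Matrix (Fin p ⊕ Fin q) (Fin p) F := x.submatrix id Sum.inl

theorem frame_mul (x y : Mat F p q) : frame (x * y) = x * frame y := rfl

theorem frame_fromBlocks (a : Matrix (Fin p) (Fin p) F) (X : Matrix (Fin p) (Fin q) F)
    (b : Matrix (Fin q) (Fin q) F) (x : Mat F p q) :
    x * frame (fromBlocks a X 0 b) = frame x * a := by
  ext i j
  simp [frame, Matrix.mul_apply]

theorem frame_conjTranspose_mul {x : Mat F p q} (hx : star x * x = 1) :
    (frame x)ᴴ * frame x = 1 := by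
  have h : (frame x)ᴴ * frame x = (star x * x).toBlocks₁₁ := rfl
  rw [h, hx, ← fromBlocks_one, toBlocks_fromBlocks₁₁]

theorem abs_realDet_levi {m : G F p q} (hm : m ∈ M F p q) (t : ℝ) (X : Matrix (Fin p) (Fin q) F) :
    ∃ (a : Matrix (Fin p) (Fin p) F) (Y : Matrix (Fin p) (Fin q) F) (b : Matrix (Fin q) (Fin q) F),
      m.mat * aMat F p q t * nMat X = fromBlocks a Y 0 b ∧
      |realDet a| = Real.exp (t * blockWeight F p q) := by
  obtain ⟨a, b, hab, ha⟩ := hm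
  refine ⟨a * (Real.exp (t * ((q : ℝ) / ((p : ℝ) + q))) • 1),
    a * (Real.exp (t * ((q : ℝ) / ((p : ℝ) + q))) • 1) * X,
    b * (Real.exp (t * (-((p : ℝ) / ((p : ℝ) + q)))) • 1), ?_, ?_⟩
  rotate_left
  · rw [map_mul, abs_mul, ha, realDet_smul_one, ← Real.exp_nat_mul, Real.abs_exp, one_mul,
      Fintype.card_fin, blockWeight]
    push_cast
    ring_nf
  · rw [hab, aMat_eq, nMat, fromBlocks_multiply, fromBlocks_multiply]
    simp only [Matrix.mul_zero, Matrix.zero_mul, add_zero, zero_add, Matrix.mul_one]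

/-- Multiplication by `n̄(Y)` from the left leaves the upper block rows alone. Since `blockWeight`
is positive for `p, q ≥ 1`, `t` is then unique, and the choice made in `alphaPow` is harmless. -/
theorem IsAlpha.abs_realDet {x : G F p q} {t : ℝ} (h : IsAlpha x t) :
    |realDet x.mat.toBlocks₁₁| = Real.exp (t * blockWeight F p q) := by
  obtain ⟨Y, m, X, hm, hx⟩ := h
  obtain ⟨a, X', b, hab, ha⟩ := abs_realDet_levi hm t X
  rw [Matrix.mul_assoc, Matrix.mul_assoc, ← Matrix.mul_assoc m.mat, hab, nbarMat,
    fromBlocks_multiply] at hx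
  rw [hx, toBlocks_fromBlocks₁₁, Matrix.one_mul, Matrix.zero_mul, add_zero, ha]

theorem IsIwasawa.exists_frame {x : G F p q} {t : ℝ} (h : IsIwasawa x t) :
    ∃ k ∈ K F p q, ∃ b : Matrix (Fin p) (Fin p) F,
      frame x.mat = frame k.mat * b ∧ |realDet b| = Real.exp (t * blockWeight F p q) := by
  obtain ⟨k, m, X, hk, hm, hx⟩ := h
  obtain ⟨a, X', b, hab, ha⟩ := abs_realDet_levi hm t X
  refine ⟨k, hk, a, ?_, ha⟩
  rw [hx, Matrix.mul_assoc, Matrix.mul_assoc, ← Matrix.mul_assoc m.mat, hab, frame_mul,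
    frame_fromBlocks]

/-- The factor in `K` cancels from the Gram matrix. This plays for `iwasawaPow` the role that
`IsAlpha.abs_realDet` plays for `alphaPow`. -/
theorem IsIwasawa.realDet_gram {x : G F p q} {t : ℝ} (h : IsIwasawa x t) :
    realDet ((frame x.mat)ᴴ * frame x.mat) = Real.exp (t * blockWeight F p q) ^ 2 := by
  obtain ⟨k, hk, b, hb, hdet⟩ := h.exists_frame
  rw [hb, conjTranspose_mul, Matrix.mul_assoc, ← Matrix.mul_assoc (frame k.mat)ᴴ,
    frame_conjTranspose_mul hk, Matrix.one_mul, map_mul, ← star_eq_conjTranspose, realDet_star,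
    ← sq, ← sq_abs, hdet]

theorem aPow_eq (t : ℝ) (z : ℂ) :
    aPow p q t z = (Real.exp (t * blockWeight F p q) : ℂ) ^ (z / F.d) := by
  have hd : (F.d : ℂ) ≠ 0 := by exact_mod_cast (d_pos F).ne'
  rw [aPow, Complex.cpow_def_of_ne_zero (by exact_mod_cast (Real.exp_pos _).ne'),
    ← Complex.ofReal_log (Real.exp_pos _).le, Real.log_exp, blockWeight]
  congr 1
  push_cast
  field_simp

theorem alphaPow_eq (hp : 1 ≤ p) (hq : 1 ≤ q) {x : G F p q}
    (hx : realDet x.mat.toBlocks₁₁ ≠ 0) (z : ℂ) :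
    alphaPow x z = ((|realDet x.mat.toBlocks₁₁| : ℝ) : ℂ) ^ (z / F.d) := by
  have h := exists_isAlpha hp hq hx
  rw [alphaPow, dif_pos h, aPow_eq (F := F), h.choose_spec.abs_realDet]

theorem iwasawaPow_eq (hp : 1 ≤ p) (hq : 1 ≤ q) (x : G F p q) (z : ℂ) :
    iwasawaPow x z = (√(realDet ((frame x.mat)ᴴ * frame x.mat)) : ℂ) ^ (z / F.d) := by
  have h := exists_isIwasawa hp hq x
  rw [iwasawaPow, dif_pos h, aPow_eq (F := F), h.choose_spec.realDet_gram,
    Real.sqrt_sq (Real.exp_pos _).le]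

end Decompositions

open scoped ENNReal

/-! ### Lebesgue measure on matrices over `𝕂` -/

section Lebesgue

variable {F : ScalarField}

instance (F : ScalarField) : MeasureSpace F where
  volume := Measure.addHaar

instance (F : ScalarField) : (volume : Measure F).IsAddHaarMeasure :=
  inferInstanceAs (Measure.addHaar : Measure F).IsAddHaarMeasure

variable {ι κ : Type} [Fintype ι] [Fintype κ]

instance : (volume : Measure (κ → F)).IsAddHaarMeasure :=
  inferInstanceAs (Measure.pi fun _ : κ => (volume : Measure F)).IsAddHaarMeasure

instance : (volume : Measure (ι → κ → F)).IsAddHaarMeasure :=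
  Measure.pi.isAddHaarMeasure (fun _ : ι => (volume : Measure (κ → F)))

/-- The Gaussian weight `exp(-|Z|²)`. -/
def gaussWeight (Z : ι → κ → F) : ℝ≥0∞ := ENNReal.ofReal (Real.exp (-normSq Z))

@[fun_prop]
theorem continuous_normSq : Continuous (normSq : (ι → κ → F) → ℝ) := by
  unfold normSq
  fun_prop

@[fun_prop]
theorem measurable_gaussWeight : Measurable (gaussWeight : (ι → κ → F) → ℝ≥0∞) := by
  unfold gaussWeight
  fun_prop

theorem gaussWeight_ne_zero (Z : ι → κ → F) : gaussWeight Z ≠ 0 := by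
  simp [gaussWeight, Real.exp_pos]

theorem gaussWeight_ne_top (Z : ι → κ → F) : gaussWeight Z ≠ ∞ := ENNReal.ofReal_ne_top

theorem integrable_gauss_scalar : Integrable (fun x : F => Real.exp (-‖x‖ ^ 2)) := by
  refine (integrable_fun_norm_addHaar volume (f := fun y => Real.exp (-y ^ 2))).2 ?_
  have hd : (0 : ℝ) ≤ ((Module.finrank ℝ F - 1 : ℕ) : ℝ) := Nat.cast_nonneg _
  have h := integrableOn_rpow_mul_exp_neg_mul_sq (b := 1) one_pos
    (s := ((Module.finrank ℝ F - 1 : ℕ) : ℝ)) (by linarith)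
  refine h.congr_fun (fun y _ => ?_) measurableSet_Ioi
  simp [Real.rpow_natCast]

theorem integrable_gauss : Integrable (fun Z : ι → κ → F => Real.exp (-normSq Z)) := by
  have h₁ : Integrable (fun z : κ → F => ∏ j, Real.exp (-‖z j‖ ^ 2)) :=
    Integrable.fintype_prod (f := fun (_ : κ) (x : F) => Real.exp (-‖x‖ ^ 2))
      (μ := fun _ => volume) fun _ => integrable_gauss_scalar
  have h₂ : Integrable (fun Z : ι → κ → F => ∏ i, ∏ j, Real.exp (-‖Z i j‖ ^ 2)) :=
    Integrable.fintype_prod (f := fun (_ : ι) (z : κ → F) => ∏ j, Real.exp (-‖z j‖ ^ 2))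
      (μ := fun _ => volume) fun _ => h₁
  simpa only [normSq, ← Finset.sum_neg_distrib, Real.exp_sum] using h₂

theorem lintegral_gaussWeight_ne_top : ∫⁻ Z : ι → κ → F, gaussWeight Z ≠ ∞ := by
  have h := (hasFiniteIntegral_iff_ofReal
    (Filter.Eventually.of_forall fun Z => (Real.exp_pos _).le)).1
    (integrable_gauss (F := F) (ι := ι) (κ := κ)).2
  exact h.ne

theorem lintegral_gaussWeight_ne_zero : ∫⁻ Z : ι → κ → F, gaussWeight Z ≠ 0 := by
  intro h
  rw [lintegral_eq_zero_iff (by fun_prop)] at h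
  have h' : ∀ᵐ Z : ι → κ → F, False := by
    filter_upwards [h] with Z hZ using gaussWeight_ne_zero Z hZ
  rw [Filter.eventually_false_iff_eq_bot, ae_eq_bot] at h'
  exact NeZero.ne _ h'

theorem lintegral_comp_linearMap {E : Type} [NormedAddCommGroup E] [NormedSpace ℝ E]
    [MeasurableSpace E] [BorelSpace E] [FiniteDimensional ℝ E] (μ : Measure E)
    [μ.IsAddHaarMeasure] {L : E →ₗ[ℝ] E} (hL : LinearMap.det L ≠ 0) {f : E → ℝ≥0∞}
    (hf : Measurable f) :
    ∫⁻ x, f (L x) ∂μ = ENNReal.ofReal |LinearMap.det L|⁻¹ * ∫⁻ x, f x ∂μ := by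
  have hm : Measurable L := L.continuous_of_finiteDimensional.measurable
  rw [← lintegral_map hf hm, Measure.map_linearMap_addHaar_eq_smul_addHaar μ hL,
    lintegral_smul_measure, abs_inv, smul_eq_mul]

/-- A linear map scales Lebesgue measure by a constant. Testing on the Gaussian, which `L` preserves
and whose integral is finite and nonzero, shows that the constant is one. -/
theorem lintegral_comp_of_normSq {L : (ι → κ → F) →ₗ[ℝ] (ι → κ → F)}
    (hL : ∀ Z, normSq (L Z) = normSq Z) {f : (ι → κ → F) → ℝ≥0∞} (hf : Measurable f) :
    ∫⁻ Z, f (L Z) = ∫⁻ Z, f Z := by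
  have hdet : LinearMap.det L ≠ 0 := by
    have hinj : Function.Injective L := by
      rw [injective_iff_map_eq_zero]
      intro Z hZ
      rw [← normSq_eq_zero_iff, ← hL, hZ, normSq_eq_zero_iff]
    have : IsUnit L := (LinearMap.isUnit_iff_ker_eq_bot _).2 (LinearMap.ker_eq_bot.2 hinj)
    exact ((LinearMap.isUnit_iff_isUnit_det _).1 this).ne_zero
  have h := lintegral_comp_linearMap volume hdet (f := gaussWeight) (by fun_prop)
  simp only [gaussWeight, hL] at h
  have h1 : ENNReal.ofReal |LinearMap.det L|⁻¹ = 1 := by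
    rw [← ENNReal.mul_left_inj lintegral_gaussWeight_ne_zero (lintegral_gaussWeight_ne_top
      (F := F) (ι := ι) (κ := κ)), one_mul]
    exact h.symm
  rw [lintegral_comp_linearMap volume hdet hf, h1, one_mul]

/-- Right multiplication by a square matrix. -/
def rightMul {ι : Type} [DecidableEq κ] (a : Matrix κ κ F) : (ι → κ → F) →ₗ[ℝ] (ι → κ → F) :=
  LinearMap.pi fun i => (rowAction a).comp (LinearMap.proj i)

theorem rightMul_apply {ι : Type} [DecidableEq κ] (a : Matrix κ κ F) (Z : ι → κ → F) :
    rightMul a Z = Matrix.of Z * a := rfl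

theorem det_rightMul [DecidableEq κ] (a : Matrix κ κ F) :
    LinearMap.det (rightMul a : (ι → κ → F) →ₗ[ℝ] (ι → κ → F)) =
      realDet a ^ Fintype.card ι := by
  rw [rightMul, LinearMap.det_pi, Finset.prod_const, det_rowAction, Finset.card_univ]

/-- Left multiplication by a square matrix. -/
def leftMul {κ : Type} (a : Matrix ι ι F) : (ι → κ → F) →ₗ[ℝ] (ι → κ → F) where
  toFun Z := a * Matrix.of Z
  map_add' Z W := Matrix.mul_add a (Matrix.of Z) (Matrix.of W)
  map_smul' r Z := Matrix.mul_smul a r (Matrix.of Z)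

theorem leftMul_apply {κ : Type} (a : Matrix ι ι F) (Z : ι → κ → F) :
    leftMul a Z = a * Matrix.of Z := rfl

/-- The conjugate transpose as an `ℝ`-linear equivalence. -/
def conjTransposeEquiv (F : ScalarField) (ι κ : Type) : (κ → ι → F) ≃ₗ[ℝ] (ι → κ → F) where
  toFun Z := (Matrix.of Z)ᴴ
  invFun Z := (Matrix.of Z)ᴴ
  left_inv Z := conjTranspose_conjTranspose (Matrix.of Z)
  right_inv Z := conjTranspose_conjTranspose (Matrix.of Z)
  map_add' Z W := conjTranspose_add (Matrix.of Z) (Matrix.of W)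
  map_smul' r Z := by
    funext i j
    exact star_smul r (Z j i)

theorem det_leftMul [DecidableEq ι] (a : Matrix ι ι F) :
    LinearMap.det (leftMul a : (ι → κ → F) →ₗ[ℝ] (ι → κ → F)) = realDet a ^ Fintype.card κ := by
  rw [← realDet_star, ← det_rightMul (ι := κ),
    ← LinearMap.det_conj (rightMul (star a)) (conjTransposeEquiv F ι κ)]
  congr 1
  refine LinearMap.ext fun Z => ?_
  change a * Matrix.of Z = ((Matrix.of Z)ᴴ * aᴴ)ᴴ
  rw [conjTranspose_mul, conjTranspose_conjTranspose, conjTranspose_conjTranspose]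

/-- The absolute value of the real determinant of a square matrix. -/
def absDet [DecidableEq ι] (Z : ι → ι → F) : ℝ := |realDet (Matrix.of Z)|

theorem absDet_nonneg [DecidableEq ι] (Z : ι → ι → F) : 0 ≤ absDet Z := abs_nonneg _

theorem absDet_mul [DecidableEq ι] (a b : Matrix ι ι F) : absDet (a * b) = absDet a * absDet b := by
  change |realDet (a * b)| = |realDet a| * |realDet b|
  rw [map_mul, abs_mul]

@[fun_prop]
theorem continuous_absDet [DecidableEq ι] : Continuous (absDet : (ι → ι → F) → ℝ) :=
  continuous_abs.comp continuous_realDet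

theorem lintegral_rightMul [DecidableEq κ] {a : Matrix κ κ F} (ha : realDet a ≠ 0)
    {f : (ι → κ → F) → ℝ≥0∞} (hf : Measurable f) :
    ENNReal.ofReal (absDet a ^ Fintype.card ι) * ∫⁻ Z : ι → κ → F, f (rightMul a Z) = ∫⁻ Z, f Z := by
  have ha' : 0 < |realDet a| := abs_pos.2 ha
  rw [lintegral_comp_linearMap volume (by rw [det_rightMul]; exact pow_ne_zero _ ha) hf,
    det_rightMul, ← mul_assoc, ← ENNReal.ofReal_mul (by positivity [absDet_nonneg a]), abs_pow]
  change ENNReal.ofReal (|realDet a| ^ _ * _) * _ = _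
  rw [mul_inv_cancel₀ (by positivity), ENNReal.ofReal_one, one_mul]

theorem lintegral_leftMul [DecidableEq ι] {a : Matrix ι ι F} (ha : realDet a ≠ 0)
    {f : (ι → κ → F) → ℝ≥0∞} (hf : Measurable f) :
    ∫⁻ Z : ι → κ → F, f (leftMul a Z) =
      ENNReal.ofReal (absDet a ^ Fintype.card κ)⁻¹ * ∫⁻ Z, f Z := by
  rw [lintegral_comp_linearMap volume (by rw [det_leftMul]; exact pow_ne_zero _ ha) hf,
    det_leftMul, abs_pow]
  rfl

end Lebesgue

/-! ### The determinant of a Gaussian matrix -/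

section Recursion

variable {F : ScalarField}

theorem lintegral_cons {α : Type} [MeasureSpace α] [SigmaFinite (volume : Measure α)] (n : ℕ)
    {f : (Fin (n + 1) → α) → ℝ≥0∞} (hf : Measurable f) :
    ∫⁻ Z, f Z = ∫⁻ z : α, ∫⁻ Z : Fin n → α, f (Fin.cons z Z) := by
  have h := (volume_preserving_piFinSuccAbove (fun _ : Fin (n + 1) => α) 0).symm
  rw [← h.lintegral_comp hf]
  have hm : Measurable fun x : α × (Fin n → α) =>
      f ((MeasurableEquiv.piFinSuccAbove (fun _ : Fin (n + 1) => α) 0).symm x) :=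
    hf.comp (MeasurableEquiv.measurable _)
  rw [Measure.volume_eq_prod, lintegral_prod _ hm.aemeasurable]
  simp [MeasurableEquiv.piFinSuccAbove, Fin.insertNthEquiv]

theorem lintegral_cons_columns (m n : ℕ) {f : (Fin m → Fin (n + 1) → F) → ℝ≥0∞}
    (hf : Measurable f) :
    ∫⁻ Z, f Z = ∫⁻ w : Fin m → F, ∫⁻ Z : Fin m → Fin n → F, f (fun i => Fin.cons (w i) (Z i)) := by
  have h₁ : MeasurePreserving (fun (x : Fin m → F × (Fin n → F)) i =>
      (MeasurableEquiv.piFinSuccAbove (fun _ : Fin (n + 1) => F) 0).symm (x i)) :=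
    measurePreserving_pi _ _ fun _ =>
      (volume_preserving_piFinSuccAbove (fun _ : Fin (n + 1) => (F : Type)) 0).symm
  have h₂ := (volume_measurePreserving_arrowProdEquivProdArrow F (Fin n → F) (Fin m)).symm
  have h := h₁.comp h₂
  rw [← h.lintegral_comp hf, Measure.volume_eq_prod, lintegral_prod]
  · simp [MeasurableEquiv.piFinSuccAbove, Fin.insertNthEquiv,
      MeasurableEquiv.arrowProdEquivProdArrow, Equiv.arrowProdEquivProdArrow]
  · exact (hf.comp h.measurable).aemeasurable

theorem normSq_cons {κ : Type} [Fintype κ] {n : ℕ} (z : κ → F) (Z : Fin n → κ → F) :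
    normSq (Fin.cons z Z : Fin (n + 1) → κ → F) = ∑ j, ‖z j‖ ^ 2 + normSq Z := by
  simp [normSq, Fin.sum_univ_succ]

theorem normSq_cons_columns {m n : ℕ} (w : Fin m → F) (Z : Fin m → Fin n → F) :
    normSq (fun i => (Fin.cons (w i) (Z i) : Fin (n + 1) → F)) = ∑ i, ‖w i‖ ^ 2 + normSq Z := by
  simp [normSq, Fin.sum_univ_succ, Finset.sum_add_distrib]

theorem absDet_cons_single {n : ℕ} {r : ℝ} (hr : 0 ≤ r) (w : Fin n → F) (Z : Fin n → Fin n → F) :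
    absDet (Fin.cons (Pi.single 0 (algebraMap ℝ F r)) fun i => Fin.cons (w i) (Z i)) =
      r ^ F.d * absDet Z := by
  have h : (Matrix.of (Fin.cons (Pi.single 0 (algebraMap ℝ F r)) fun i => Fin.cons (w i) (Z i)) :
      Matrix (Fin (n + 1)) (Fin (n + 1)) F) = (fromBlocks (r • 1 : Matrix Unit Unit F) 0
        (Matrix.of fun i _ => w i) (Matrix.of Z)).submatrix (headTail n).symm (headTail n).symm := by
    ext i j
    refine Fin.cases ?_ (fun i => ?_) i <;> refine Fin.cases ?_ (fun j => ?_) j <;>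
      simp [Algebra.algebraMap_eq_smul_one]
  -- The matrix is block lower triangular; the adjoint makes it block upper triangular without
  -- changing the determinant.
  rw [absDet, h, realDet_submatrix, ← realDet_star, star_eq_conjTranspose,
    fromBlocks_conjTranspose, conjTranspose_zero, realDet_fromBlocks, ← star_eq_conjTranspose,
    ← star_eq_conjTranspose, realDet_star, realDet_star, realDet_smul_one, abs_mul,
    Fintype.card_unit, mul_one, abs_of_nonneg (pow_nonneg hr _)]
  rfl

/-- A unitary matrix `U`, depending on the first row `z`, rotates `z` to `(|z|, 0, …, 0)`. Expansion
along this row gives `|z|^d` times the smaller determinant; the rest `w` of the first column does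
not enter it. -/
theorem lintegral_absDet_succ (n : ℕ) {f : ℝ → ℝ≥0∞} (hf : Measurable f) :
    ∫⁻ Z : Fin (n + 1) → Fin (n + 1) → F, f (absDet Z) * gaussWeight Z =
      ∫⁻ z : Fin (n + 1) → F, ∫⁻ w : Fin n → F, ∫⁻ Z : Fin n → Fin n → F,
        f (√(∑ j, ‖z j‖ ^ 2) ^ F.d * absDet Z) *
          (ENNReal.ofReal (Real.exp (-∑ j, ‖z j‖ ^ 2)) *
            (ENNReal.ofReal (Real.exp (-∑ j, ‖w j‖ ^ 2)) * gaussWeight Z)) := by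
  rw [lintegral_cons n (by fun_prop)]
  refine lintegral_congr_ae ?_
  have h0 : ∀ᵐ z : Fin (n + 1) → F, z ≠ 0 := by
    rw [ae_iff]
    simp
  filter_upwards [h0] with z hz
  obtain ⟨U, hU, hzU⟩ := exists_unitary_vecMul 0 hz
  set r := √(∑ j, ‖z j‖ ^ 2)
  have hdet : ∀ Z : Fin n → Fin (n + 1) → F, absDet (Fin.cons z Z) =
      absDet (Fin.cons (Pi.single 0 (algebraMap ℝ F r)) (rightMul U Z)) := by
    intro Z
    have h1 : Matrix.of (Fin.cons (Pi.single 0 (algebraMap ℝ F r)) (rightMul U Z)) =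
        Matrix.of (Fin.cons z Z) * U := by
      ext i j
      refine Fin.cases ?_ (fun i => ?_) i
      · exact congrFun hzU.symm j
      · rfl
    rw [absDet, absDet, h1, map_mul, abs_mul, abs_realDet_of_unitary hU, mul_one]
  have hw : ∀ Z : Fin n → Fin (n + 1) → F, gaussWeight (Fin.cons z Z : Fin (n + 1) → _ → F) =
      ENNReal.ofReal (Real.exp (-∑ j, ‖z j‖ ^ 2)) * gaussWeight (rightMul U Z) := by
    intro Z
    rw [gaussWeight, gaussWeight, normSq_cons, neg_add, Real.exp_add,
      ENNReal.ofReal_mul (Real.exp_pos _).le, rightMul_apply, normSq_mul_unitary hU]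
    rfl
  have hmeas : Measurable fun Z : Fin n → Fin (n + 1) → F =>
      f (absDet (Fin.cons (Pi.single 0 (algebraMap ℝ F r)) Z)) *
        (ENNReal.ofReal (Real.exp (-∑ j, ‖z j‖ ^ 2)) * gaussWeight Z) := by
    fun_prop
  simp only [hdet, hw]
  -- For fixed `z`, the other rows are rotated by the same `U`, which preserves their Lebesgue
  -- measure.
  rw [lintegral_comp_of_normSq (L := rightMul U)
    (fun Z => normSq_mul_unitary hU (Matrix.of Z)) hmeas, lintegral_cons_columns n n hmeas]
  simp only [absDet_cons_single (r := r) (Real.sqrt_nonneg _), gaussWeight, normSq_cons_columns, neg_add,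
    Real.exp_add, ENNReal.ofReal_mul (Real.exp_pos _).le]

/-- Induction through `lintegral_absDet_succ`, applied to the indicator of `{0}`: almost surely `z ≠
0` and the smaller determinant does not vanish. -/
theorem ae_absDet_ne_zero (n : ℕ) : ∀ᵐ Z : Fin n → Fin n → F, absDet Z ≠ 0 := by
  induction n with
  | zero =>
    refine Filter.Eventually.of_forall fun Z => ?_
    have : (Matrix.of Z : Matrix (Fin 0) (Fin 0) F) = 1 := Subsingleton.elim _ _
    simp [absDet, this]
  | succ n ih =>
    have hm : Measurable (Set.indicator {(0 : ℝ)} (fun _ => (1 : ℝ≥0∞))) :=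
      measurable_const.indicator (measurableSet_singleton 0)
    have h := lintegral_absDet_succ (F := F) n hm
    have hz : ∀ᵐ z : Fin (n + 1) → F, z ≠ 0 := by
      rw [ae_iff]
      simp
    have h0 : (∫⁻ z : Fin (n + 1) → F, ∫⁻ w : Fin n → F, ∫⁻ Z : Fin n → Fin n → F,
        Set.indicator {(0 : ℝ)} (fun _ => (1 : ℝ≥0∞)) (√(∑ j, ‖z j‖ ^ 2) ^ F.d * absDet Z) *
          (ENNReal.ofReal (Real.exp (-∑ j, ‖z j‖ ^ 2)) *
            (ENNReal.ofReal (Real.exp (-∑ j, ‖w j‖ ^ 2)) * gaussWeight Z))) = 0 := by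
      rw [lintegral_congr_ae (g := 0), lintegral_zero_fun]
      filter_upwards [hz] with z hz
      have hpos : 0 < ∑ i, ‖z i‖ ^ 2 := by
        obtain ⟨i, hi⟩ := Function.ne_iff.1 hz
        have : 0 < ‖z i‖ ^ 2 := pow_pos (norm_pos_iff.2 hi) 2
        exact this.trans_le (Finset.single_le_sum (f := fun i => ‖z i‖ ^ 2)
          (fun _ _ => by positivity) (Finset.mem_univ i))
      have hr : √(∑ i, ‖z i‖ ^ 2) ≠ 0 := (Real.sqrt_pos.2 hpos).ne'
      refine (lintegral_congr_ae (g := 0) (Filter.Eventually.of_forall fun w => ?_)).trans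
        lintegral_zero_fun
      refine (lintegral_congr_ae (g := 0) ?_).trans lintegral_zero_fun
      filter_upwards [ih] with Z hZ
      have : √(∑ j, ‖z j‖ ^ 2) ^ F.d * absDet Z ≠ 0 := mul_ne_zero (pow_ne_zero _ hr) hZ
      simp [Set.indicator_of_notMem (s := {(0 : ℝ)}) this]
    rw [h0, lintegral_eq_zero_iff (by fun_prop)] at h
    filter_upwards [h] with Z hZ hd
    simp [hd, gaussWeight_ne_zero] at hZ

end Recursion

/-! ### Moments of the determinant of a Gaussian matrix -/

section Moments

variable {F : ScalarField}

theorem integrable_gauss_row {κ : Type} [Fintype κ] :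
    Integrable (fun z : κ → F => Real.exp (-∑ j, ‖z j‖ ^ 2)) := by
  have h : Integrable (fun z : κ → F => ∏ j, Real.exp (-‖z j‖ ^ 2)) :=
    Integrable.fintype_prod (f := fun (_ : κ) (x : F) => Real.exp (-‖x‖ ^ 2))
      (μ := fun _ => volume) fun _ => integrable_gauss_scalar
  simpa only [← Finset.sum_neg_distrib, Real.exp_sum] using h

/-- The Gaussian measure on row vectors, not normalized. -/
def gaussRow (F : ScalarField) (κ : Type) [Fintype κ] : Measure (κ → F) :=
  volume.withDensity fun z => ENNReal.ofReal (Real.exp (-∑ j, ‖z j‖ ^ 2))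

/-- The Gaussian measure on matrices, not normalized. -/
def gaussMat (F : ScalarField) (ι κ : Type) [Fintype ι] [Fintype κ] : Measure (ι → κ → F) :=
  volume.withDensity gaussWeight

instance {κ : Type} [Fintype κ] : IsFiniteMeasure (gaussRow F κ) := by
  refine isFiniteMeasure_withDensity ?_
  exact ((hasFiniteIntegral_iff_ofReal
    (Filter.Eventually.of_forall fun Z => (Real.exp_pos _).le)).1 integrable_gauss_row.2).ne

instance {κ : Type} [Fintype κ] : NeZero (gaussRow F κ) := by
  refine ⟨fun h => ?_⟩
  rw [gaussRow, withDensity_eq_zero_iff (Measurable.aemeasurable (by fun_prop))] at h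
  have h' : ∀ᵐ z : κ → F, False := by
    filter_upwards [h] with z hz
    simp [(Real.exp_pos _).not_ge] at hz
  rw [Filter.eventually_false_iff_eq_bot, ae_eq_bot] at h'
  exact NeZero.ne _ h'

instance {ι κ : Type} [Fintype ι] [Fintype κ] : IsFiniteMeasure (gaussMat F ι κ) :=
  isFiniteMeasure_withDensity lintegral_gaussWeight_ne_top

instance {ι κ : Type} [Fintype ι] [Fintype κ] : NeZero (gaussMat F ι κ) := by
  refine ⟨fun h => lintegral_gaussWeight_ne_zero (F := F) (ι := ι) (κ := κ) ?_⟩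
  rw [gaussMat, withDensity_eq_zero_iff (by fun_prop)] at h
  rw [lintegral_congr_ae h]
  simp

theorem lintegral_gaussRow {κ : Type} [Fintype κ] {f : (κ → F) → ℝ≥0∞} (hf : Measurable f) :
    ∫⁻ z, f z ∂gaussRow F κ =
      ∫⁻ z, f z * ENNReal.ofReal (Real.exp (-∑ j, ‖z j‖ ^ 2)) := by
  rw [gaussRow, lintegral_withDensity_eq_lintegral_mul _ (by fun_prop) hf]
  simp only [Pi.mul_apply, mul_comm]

theorem lintegral_gaussMat {ι κ : Type} [Fintype ι] [Fintype κ] {f : (ι → κ → F) → ℝ≥0∞}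
    (hf : Measurable f) : ∫⁻ Z, f Z ∂gaussMat F ι κ = ∫⁻ Z, f Z * gaussWeight Z := by
  rw [gaussMat, lintegral_withDensity_eq_lintegral_mul _ (by fun_prop) hf]
  simp only [Pi.mul_apply, mul_comm]

/-- The recursion as an identity of laws, so that it yields both integrability and values of complex
moments. The scalar is the Gaussian mass of the unused column `w`. -/
theorem map_absDet_gaussMat_succ (n : ℕ) :
    (gaussMat F (Fin (n + 1)) (Fin (n + 1))).map absDet =
      gaussRow F (Fin n) Set.univ • ((gaussRow F (Fin (n + 1))).prod
        (gaussMat F (Fin n) (Fin n))).map fun x => √(∑ j, ‖x.1 j‖ ^ 2) ^ F.d * absDet x.2 := by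
  refine Measure.ext_of_lintegral _ fun f hf => ?_
  rw [lintegral_map hf (by fun_prop), lintegral_smul_measure, lintegral_map hf (by fun_prop),
    lintegral_prod _ (by fun_prop), lintegral_gaussMat (by fun_prop),
    lintegral_absDet_succ n hf, lintegral_gaussRow (by fun_prop), ← setLIntegral_one,
    setLIntegral_univ, lintegral_gaussRow (by fun_prop), smul_eq_mul,
    ← lintegral_const_mul _ (by fun_prop)]
  refine lintegral_congr fun z => ?_
  rw [← lintegral_mul_const _ (by fun_prop)]
  refine lintegral_congr fun w => ?_
  rw [lintegral_gaussMat (by fun_prop), ← lintegral_mul_const _ (by fun_prop),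
    ← lintegral_const_mul _ (by fun_prop)]
  refine lintegral_congr fun Z => ?_
  ring

/-- The substitution `x = y²` in Euler's integral for `Γ(z/2)`. -/
theorem mellin_gauss {z : ℂ} (hz : 0 < z.re) :
    IntegrableOn (fun y : ℝ => (y : ℂ) ^ (z - 1) * Real.exp (-y ^ 2)) (Set.Ioi 0) ∧
      ∫ y : ℝ in Set.Ioi 0, (y : ℂ) ^ (z - 1) * Real.exp (-y ^ 2) =
        2⁻¹ * Complex.Gamma (z / 2) := by
  have hz' : 0 < (z / ((2 : ℝ) : ℂ)).re := by
    rw [Complex.div_ofReal_re]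
    positivity
  have h₁ : MellinConvergent (fun x : ℝ => ((Real.exp (-x) : ℝ) : ℂ)) (z / ((2 : ℝ) : ℂ)) := by
    refine (Complex.GammaIntegral_convergent hz').congr_fun (fun x _ => ?_) measurableSet_Ioi
    simp [mul_comm]
  have h₂ := (MellinConvergent.comp_rpow (two_ne_zero (α := ℝ))).2 h₁
  have h₃ := mellin_comp_rpow (fun x : ℝ => ((Real.exp (-x) : ℝ) : ℂ)) z 2
  rw [← Complex.GammaIntegral_eq_mellin, ← Complex.Gamma_eq_integral hz'] at h₃
  refine ⟨?_, ?_⟩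
  · simpa [MellinConvergent] using h₂
  · simpa [mellin] using h₃

theorem radial_moment (n : ℕ) : ∃ C : ℝ, 0 < C ∧ ∀ s : ℂ, -1 < s.re →
    Integrable (fun z : Fin (n + 1) → F => ((√(∑ j, ‖z j‖ ^ 2) ^ F.d : ℝ) : ℂ) ^ s)
      (gaussRow F (Fin (n + 1))) ∧
    ∫ z, ((√(∑ j, ‖z j‖ ^ 2) ^ F.d : ℝ) : ℂ) ^ s ∂(gaussRow F (Fin (n + 1))) =
      C * Complex.Gamma ((F.d * (n + 1) + F.d * s) / 2) := by
  let E := PiLp 2 fun _ : Fin (n + 1) => (F : Type)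
  let e : (Fin (n + 1) → F) ≃L[ℝ] E := (PiLp.continuousLinearEquiv 2 ℝ _).symm
  let μ : Measure E := Measure.map e volume
  have hμ : μ.IsAddHaarMeasure := e.isAddHaarMeasure_map volume
  have hdim : Module.finrank ℝ E = F.d * (n + 1) := by
    rw [← e.toLinearEquiv.finrank_eq, Module.finrank_pi_fintype, Finset.sum_const,
      Finset.card_univ, Fintype.card_fin, smul_eq_mul, mul_comm, ScalarField.d]
  have hd := d_pos F
  have hdim0 : 0 < F.d * (n + 1) := by positivity
  have hnorm : ∀ z, ‖e z‖ = √(∑ j, ‖z j‖ ^ 2) := fun z => PiLp.norm_eq_of_L2 _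
  have he : MeasurableEmbedding e := e.toHomeomorph.measurableEmbedding
  -- Polar coordinates in the Euclidean space `E`: its dimension times the volume of the unit ball
  -- is the area of the sphere, and `2⁻¹` comes from `mellin_gauss`.
  refine ⟨F.d * (n + 1) * μ.real (Metric.ball 0 1) * 2⁻¹, ?_, fun s hs => ?_⟩
  · have : 0 < μ.real (Metric.ball 0 1) :=
      ENNReal.toReal_pos (Metric.measure_ball_pos μ 0 one_pos).ne' measure_ball_lt_top.ne
    positivity
  let f : ℝ → ℂ := fun y => Real.exp (-y ^ 2) • ((y ^ F.d : ℝ) : ℂ) ^ s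
  have hw : 0 < ((F.d : ℂ) * (n + 1) + F.d * s).re := by
    have h1 : ((F.d : ℂ) * (n + 1) + F.d * s).re = F.d * (n + 1 + s.re) := by
      simp
      ring
    rw [h1]
    have : (0 : ℝ) < n + 1 + s.re := by
      have : (0 : ℝ) ≤ n := Nat.cast_nonneg n
      linarith
    positivity
  obtain ⟨hint, hval⟩ := mellin_gauss hw
  have hcongr : Set.EqOn (fun y : ℝ => (y : ℂ) ^ ((F.d : ℂ) * (n + 1) + F.d * s - 1) *
      Real.exp (-y ^ 2)) (fun y => y ^ (Module.finrank ℝ E - 1) • f y) (Set.Ioi 0) := by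
    intro y hy
    have hy' : (y : ℂ) ≠ 0 := Complex.ofReal_ne_zero.2 (ne_of_gt hy)
    have h1 : (y : ℂ) ^ ((F.d : ℂ) * (n + 1) + F.d * s - 1) =
        (y : ℂ) ^ (Module.finrank ℝ E - 1) * ((y ^ F.d : ℝ) : ℂ) ^ s := by
      rw [hdim, ← Real.rpow_natCast y F.d,
        ← Complex.cpow_mul_ofReal_nonneg (le_of_lt hy), ← Complex.cpow_natCast,
        ← Complex.cpow_add _ _ hy', Nat.cast_sub hdim0]
      push_cast
      congr 1
      ring
    simp only [f, h1, Complex.real_smul]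
    push_cast
    ring
  have hgauss : ∀ g : (Fin (n + 1) → F) → ℂ, Measurable g →
      (Integrable g (gaussRow F (Fin (n + 1))) ↔
        Integrable (fun z => Real.exp (-∑ j, ‖z j‖ ^ 2) • g z)) ∧
      ∫ z, g z ∂(gaussRow F (Fin (n + 1))) = ∫ z, Real.exp (-∑ j, ‖z j‖ ^ 2) • g z := by
    intro g hg
    constructor
    · rw [gaussRow, integrable_withDensity_iff_integrable_smul' (by fun_prop) (by simp)]
      simp [ENNReal.toReal_ofReal, (Real.exp_pos _).le]
    · rw [gaussRow, integral_withDensity_eq_integral_toReal_smul (by fun_prop) (by simp)]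
      simp [ENNReal.toReal_ofReal, (Real.exp_pos _).le]
  have hfz : ∀ z : Fin (n + 1) → F, Real.exp (-∑ j, ‖z j‖ ^ 2) •
      ((√(∑ j, ‖z j‖ ^ 2) ^ F.d : ℝ) : ℂ) ^ s = f ‖e z‖ := by
    intro z
    simp only [f, hnorm, Real.sq_sqrt (Finset.sum_nonneg fun j _ => sq_nonneg ‖z j‖)]
  obtain ⟨hi, hv⟩ := hgauss _ (by fun_prop : Measurable fun z : Fin (n + 1) → F =>
    ((√(∑ j, ‖z j‖ ^ 2) ^ F.d : ℝ) : ℂ) ^ s)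
  simp only [hfz] at hi hv
  constructor
  · rw [hi]
    refine (he.integrable_map_iff (g := fun x => f ‖x‖)).1 ?_
    exact (integrable_fun_norm_addHaar μ).2 (hint.congr_fun hcongr measurableSet_Ioi)
  · rw [hv, ← he.integral_map (fun x => f ‖x‖), integral_fun_norm_addHaar,
      ← setIntegral_congr_fun measurableSet_Ioi hcongr, hval, hdim]
    simp only [nsmul_eq_mul, Complex.real_smul]
    push_cast
    ring

/-- Each step of the recursion contributes one radial moment, hence one Gamma factor. The constant
need not be known, only that it does not depend on `s`: it cancels in quotients. The last factor,
with argument `d(1 + s)/2`, dictates `Re s > -1`. -/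
theorem gaussMat_moment (n : ℕ) : ∃ C : ℝ, 0 < C ∧ ∀ s : ℂ, -1 < s.re →
    Integrable (fun Z => (absDet Z : ℂ) ^ s) (gaussMat F (Fin n) (Fin n)) ∧
    ∫ Z, (absDet Z : ℂ) ^ s ∂(gaussMat F (Fin n) (Fin n)) =
      C * ∏ j : Fin n, Complex.Gamma ((F.d * (n - (j : ℕ)) + F.d * s) / 2) := by
  induction n with
  | zero =>
    refine ⟨(gaussMat F (Fin 0) (Fin 0)).real Set.univ, ?_, fun s hs => ?_⟩
    · exact ENNReal.toReal_pos (NeZero.ne _) (measure_ne_top _ _)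
    · have h : ∀ Z : Fin 0 → Fin 0 → F, absDet Z = 1 := fun Z => by
        have : (Matrix.of Z : Matrix (Fin 0) (Fin 0) F) = 1 := Subsingleton.elim _ _
        simp [absDet, this]
      simp [h]
  | succ n ih =>
    obtain ⟨C₁, hC₁, h₁⟩ := radial_moment (F := F) n
    obtain ⟨C₂, hC₂, h₂⟩ := ih
    have hc : gaussRow F (Fin n) Set.univ ≠ ∞ := measure_ne_top _ _
    refine ⟨(gaussRow F (Fin n)).real Set.univ * C₁ * C₂, ?_, fun s hs => ?_⟩
    · have : 0 < (gaussRow F (Fin n)).real Set.univ :=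
        ENNReal.toReal_pos (NeZero.ne _) (measure_ne_top _ _)
      positivity
    obtain ⟨hi₁, hv₁⟩ := h₁ s hs
    obtain ⟨hi₂, hv₂⟩ := h₂ s hs
    have hmul : ∀ x : (Fin (n + 1) → F) × (Fin n → Fin n → F),
        ((√(∑ j, ‖x.1 j‖ ^ 2) ^ F.d * absDet x.2 : ℝ) : ℂ) ^ s =
          ((√(∑ j, ‖x.1 j‖ ^ 2) ^ F.d : ℝ) : ℂ) ^ s * (absDet x.2 : ℂ) ^ s := fun x => by
      rw [Complex.ofReal_mul, Complex.mul_cpow_ofReal_nonneg (by positivity) (absDet_nonneg _)]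
    have hm : Measurable fun x : ℝ => (x : ℂ) ^ s := by fun_prop
    have hlaw := map_absDet_gaussMat_succ (F := F) n
    constructor
    · refine (integrable_map_measure (f := absDet) (g := fun x : ℝ => (x : ℂ) ^ s)
        hm.aestronglyMeasurable (by fun_prop)).1 ?_
      rw [hlaw]
      refine Integrable.smul_measure ?_ hc
      refine (integrable_map_measure hm.aestronglyMeasurable (by fun_prop)).2 ?_
      simp only [Function.comp_def, hmul]
      exact hi₁.mul_prod hi₂
    · rw [← integral_map (φ := absDet) (f := fun x : ℝ => (x : ℂ) ^ s) (by fun_prop)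
        hm.aestronglyMeasurable, hlaw, integral_smul_measure, integral_map (by fun_prop)
        hm.aestronglyMeasurable]
      simp only [hmul]
      rw [integral_prod_mul (f := fun z : Fin (n + 1) → F => ((√(∑ j, ‖z j‖ ^ 2) ^ F.d : ℝ) : ℂ) ^ s)
        (g := fun Z => (absDet Z : ℂ) ^ s), hv₁, hv₂, Fin.prod_univ_succ]
      simp only [Measure.real, Complex.real_smul, Fin.val_zero, Fin.val_succ]
      push_cast
      simp only [sub_zero, add_sub_add_right_eq_sub]
      ring

end Moments

/-! ### Integration over `(p+q) × p` matrices -/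

section Stack

variable {F : ScalarField} {p q : ℕ}

/-- The square root of the absolute value of the real determinant of the Gram matrix. -/
def gramVol {ι κ : Type} [Fintype ι] [Fintype κ] [DecidableEq κ] (Z : ι → κ → F) : ℝ :=
  √|realDet ((Matrix.of Z)ᴴ * Matrix.of Z)|

@[fun_prop]
theorem continuous_gramVol {ι κ : Type} [Fintype ι] [Fintype κ] [DecidableEq κ] :
    Continuous (gramVol : (ι → κ → F) → ℝ) := by
  have h : Continuous fun Z : ι → κ → F => (Matrix.of Z)ᴴ * Matrix.of Z :=
    (Continuous.matrix_conjTranspose (A := fun Z : ι → κ → F => Matrix.of Z)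
      continuous_id).matrix_mul continuous_id
  exact (continuous_abs.comp (continuous_realDet.comp h)).sqrt

theorem gramVol_unitary_mul {ι κ : Type} [Fintype ι] [DecidableEq ι] [Fintype κ] [DecidableEq κ]
    {U : Matrix ι ι F} (hU : star U * U = 1) (Z : ι → κ → F) :
    gramVol (leftMul U Z) = gramVol Z := by
  change √|realDet ((U * Matrix.of Z)ᴴ * (U * Matrix.of Z))| = _
  rw [conjTranspose_mul, Matrix.mul_assoc, ← Matrix.mul_assoc Uᴴ, ← star_eq_conjTranspose U, hU,
    Matrix.one_mul, gramVol]

theorem gramVol_isometry_mul {ι κ : Type} [Fintype ι] [Fintype κ] [DecidableEq κ]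
    {V : Matrix ι κ F} (hV : Vᴴ * V = 1) (W : Matrix κ κ F) : gramVol (V * W) = absDet W := by
  change √|realDet ((V * W)ᴴ * (V * W))| = |realDet W|
  rw [conjTranspose_mul, Matrix.mul_assoc, ← Matrix.mul_assoc Vᴴ, hV, Matrix.one_mul, map_mul,
    ← star_eq_conjTranspose, realDet_star, abs_mul_self, Real.sqrt_mul_self_eq_abs]

/-- `a_P(n̄(Y))`, as the real determinant of its upper left block. -/
def nbarVol (Y : Fin q → Fin p → F) : ℝ := gramVol (frame (nbarMat (Matrix.of Y)))

@[fun_prop]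
theorem continuous_nbarVol : Continuous (nbarVol : (Fin q → Fin p → F) → ℝ) := by
  have h : Continuous fun Y : Fin q → Fin p → F => frame (nbarMat (Matrix.of Y)) :=
    (Continuous.matrix_fromBlocks continuous_const continuous_const continuous_id
      continuous_const).matrix_submatrix _ _
  exact continuous_gramVol.comp h

theorem exists_frame_nbarMat (hp : 1 ≤ p) (hq : 1 ≤ q) (Y : Fin q → Fin p → F) :
    0 < nbarVol Y ∧ ∃ k ∈ K F p q, ∃ b : Matrix (Fin p) (Fin p) F,
      frame (nbarMat (Matrix.of Y)) = frame k.mat * b ∧ |realDet b| = nbarVol Y := by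
  obtain ⟨t, ht⟩ := exists_isIwasawa hp hq (nbar (Matrix.of Y))
  obtain ⟨k, hk, b, hb, hdet⟩ := ht.exists_frame
  have hv : |realDet b| = nbarVol Y := by
    rw [nbarVol]
    change _ = gramVol (frame (nbar (Matrix.of Y)).mat)
    rw [hb, gramVol_isometry_mul (frame_conjTranspose_mul hk)]
    rfl
  exact ⟨by rw [← hv, hdet]; exact Real.exp_pos _, k, hk, b, hb, hv⟩

theorem nbarVol_pos (hp : 1 ≤ p) (hq : 1 ≤ q) (Y : Fin q → Fin p → F) : 0 < nbarVol Y :=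
  (exists_frame_nbarMat hp hq Y).1

theorem iwasawaPow_nbar (hp : 1 ≤ p) (hq : 1 ≤ q) (Y : Fin q → Fin p → F) (z : ℂ) :
    iwasawaPow (nbar (Matrix.of Y)) z = (nbarVol Y : ℂ) ^ (z / F.d) := by
  have h : 0 ≤ realDet ((frame (nbar (Matrix.of Y)).mat)ᴴ * frame (nbar (Matrix.of Y)).mat) := by
    obtain ⟨t, ht⟩ := exists_isIwasawa hp hq (nbar (Matrix.of Y))
    rw [ht.realDet_gram]
    positivity
  have hv : nbarVol Y =
      √(realDet ((frame (nbar (Matrix.of Y)).mat)ᴴ * frame (nbar (Matrix.of Y)).mat)) := by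
    rw [← abs_of_nonneg h]
    rfl
  rw [iwasawaPow_eq hp hq, hv]

theorem frame_nbarMat_mul (Y : Fin q → Fin p → F) (Z : Fin p → Fin p → F) :
    frame (nbarMat (Matrix.of Y)) * Matrix.of Z = Sum.elim Z (rightMul (Matrix.of Z) Y) := by
  funext i j
  rcases i with i | i
  · simp [frame, nbarMat, Matrix.mul_apply, Matrix.one_apply]
  · change _ = (Matrix.of Y * Matrix.of Z) i j
    simp [frame, nbarMat, Matrix.mul_apply]

theorem lintegral_stack {κ : Type} [Fintype κ] {f : (Fin p ⊕ Fin q → κ → F) → ℝ≥0∞}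
    (hf : Measurable f) : ∫⁻ Z, f Z =
      ∫⁻ Z₁ : Fin p → κ → F, ∫⁻ Z₂ : Fin q → κ → F, f (Sum.elim Z₁ Z₂) := by
  have h := volume_measurePreserving_sumPiEquivProdPi_symm (fun _ : Fin p ⊕ Fin q => κ → F)
  have h2 : ∀ x, (MeasurableEquiv.sumPiEquivProdPi (fun _ : Fin p ⊕ Fin q => κ → F)).symm x =
      Sum.elim x.1 x.2 := fun x => by
    funext i
    rcases i with i | i <;> rfl
  rw [← h.lintegral_comp hf, Measure.volume_eq_prod, lintegral_prod]
  · simp only [h2]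
  · exact (hf.comp h.measurable).aemeasurable

theorem measurable_sumElim_rightMul :
    Measurable fun x : (Fin p → Fin p → F) × (Fin q → Fin p → F) =>
      (Sum.elim x.1 (rightMul (Matrix.of x.1) x.2) : Fin p ⊕ Fin q → Fin p → F) := by
  refine measurable_pi_lambda _ fun i => ?_
  rcases i with i | i
  · simp only [Sum.elim_inl]
    fun_prop
  · refine measurable_pi_lambda _ fun j => ?_
    change Measurable fun x : (Fin p → Fin p → F) × (Fin q → Fin p → F) =>
      (Matrix.of x.2 * Matrix.of x.1) i j
    simp only [Matrix.mul_apply, Matrix.of_apply]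
    fun_prop

theorem measurable_inl_comp {κ : Type} [Fintype κ] :
    Measurable fun (Z : Fin p ⊕ Fin q → κ → F) i => Z (Sum.inl i) := by
  fun_prop

/-- The substitution `Z₂ = Y Z₁` in the lower block, legitimate for almost every upper block `Z₁`;
its Jacobian is `|det_ℝ Z₁|^q`. -/
theorem lintegral_stack_rightMul {f : (Fin p ⊕ Fin q → Fin p → F) → ℝ≥0∞} (hf : Measurable f) :
    ∫⁻ Z, f Z = ∫⁻ Y : Fin q → Fin p → F, ∫⁻ Z : Fin p → Fin p → F,
      ENNReal.ofReal (absDet Z ^ q) * f (Sum.elim Z (rightMul (Matrix.of Z) Y)) := by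
  have h₁ : ∀ᵐ Z : Fin p → Fin p → F, ∫⁻ Z₂ : Fin q → Fin p → F, f (Sum.elim Z Z₂) =
      ∫⁻ Y : Fin q → Fin p → F,
        ENNReal.ofReal (absDet Z ^ q) * f (Sum.elim Z (rightMul (Matrix.of Z) Y)) := by
    filter_upwards [ae_absDet_ne_zero p] with Z hZ
    have hm : Measurable fun Z₂ : Fin q → Fin p → F => f (Sum.elim Z Z₂) := by
      refine hf.comp (measurable_pi_lambda _ fun i => ?_)
      rcases i with i | i <;> simp only [Sum.elim_inl, Sum.elim_inr] <;> fun_prop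
    have h := lintegral_rightMul (ι := Fin q) (a := Matrix.of Z) (abs_ne_zero.1 hZ) hm
    rw [Fintype.card_fin] at h
    rw [lintegral_const_mul' _ _ ENNReal.ofReal_ne_top]
    exact h.symm
  rw [lintegral_stack hf, lintegral_congr_ae h₁, lintegral_lintegral_swap]
  have h := hf.comp (measurable_sumElim_rightMul (F := F) (p := p) (q := q))
  have h' : Measurable fun x : (Fin p → Fin p → F) × (Fin q → Fin p → F) =>
    ENNReal.ofReal (absDet x.1 ^ q) := by fun_prop
  exact (h'.mul h).aemeasurable

/-- The separation of variables behind both laws. With `Z₂ = Y Z₁` and `W = b Z₁`, `Z` is an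
isometry times `W`, so weight and Gram volume depend on `W` only. The power `p + q` of `nbarVol Y`
collects `p` from `dZ₁` and `q` from `|det Z₁|^q`. -/
theorem lintegral_gram (hp : 1 ≤ p) (hq : 1 ≤ q) {f : ℝ × ℝ → ℝ≥0∞} (hf : Measurable f) :
    ∫⁻ Z : Fin p ⊕ Fin q → Fin p → F,
        f (absDet fun i => Z (Sum.inl i), gramVol Z) * gaussWeight Z =
      ∫⁻ Y : Fin q → Fin p → F, ENNReal.ofReal (nbarVol Y ^ (p + q))⁻¹ *
        ∫⁻ W : Fin p → Fin p → F,
          f (absDet W / nbarVol Y, absDet W) * ENNReal.ofReal (absDet W ^ q) * gaussWeight W := by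
  have hm : Measurable fun Z : Fin p ⊕ Fin q → Fin p → F =>
      f (absDet fun i => Z (Sum.inl i), gramVol Z) * gaussWeight Z := by
    have := measurable_inl_comp (F := F) (p := p) (q := q) (κ := Fin p)
    fun_prop
  rw [lintegral_stack_rightMul hm]
  refine lintegral_congr fun Y => ?_
  obtain ⟨hpos, k, hk, b, hb, hdet⟩ := exists_frame_nbarMat hp hq Y
  have hb0 : realDet b ≠ 0 := by
    rw [← abs_pos, hdet]
    exact hpos
  have hk' := frame_conjTranspose_mul (F := F) hk
  have hδ : ∀ Z : Fin p → Fin p → F, absDet Z = absDet (leftMul b Z) / nbarVol Y := by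
    intro Z
    rw [eq_div_iff hpos.ne', leftMul_apply, absDet_mul, mul_comm, ← hdet]
    rfl
  have hZ : ∀ Z : Fin p → Fin p → F, Sum.elim Z (rightMul (Matrix.of Z) Y) =
      frame k.mat * (b * Matrix.of Z) := by
    intro Z
    rw [← frame_nbarMat_mul, hb, Matrix.mul_assoc]
  have hg : ∀ Z : Fin p → Fin p → F, gramVol (Sum.elim Z (rightMul (Matrix.of Z) Y)) =
      absDet (leftMul b Z) := by
    intro Z
    rw [hZ, gramVol_isometry_mul hk']
    rfl
  have hw : ∀ Z : Fin p → Fin p → F, gaussWeight (Sum.elim Z (rightMul (Matrix.of Z) Y)) =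
      gaussWeight (leftMul b Z) := by
    intro Z
    rw [gaussWeight, gaussWeight, hZ]
    congr 3
    apply normSq_congr
    rw [conjTranspose_mul, Matrix.mul_assoc, ← Matrix.mul_assoc (frame k.mat)ᴴ, hk',
      Matrix.one_mul]
    rfl
  have hcongr : ∀ Z : Fin p → Fin p → F, ENNReal.ofReal (absDet Z ^ q) *
      (f (absDet Z, gramVol (Sum.elim Z (rightMul (Matrix.of Z) Y))) *
        gaussWeight (Sum.elim Z (rightMul (Matrix.of Z) Y))) =
      (fun W : Fin p → Fin p → F => ENNReal.ofReal ((absDet W / nbarVol Y) ^ q) *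
        (f (absDet W / nbarVol Y, absDet W) * gaussWeight W)) (leftMul b Z) := by
    intro Z
    simp only [hg, hw, ← hδ]
  have hmW : Measurable fun W : Fin p → Fin p → F => ENNReal.ofReal ((absDet W / nbarVol Y) ^ q) *
      (f (absDet W / nbarVol Y, absDet W) * gaussWeight W) := by fun_prop
  refine (lintegral_congr hcongr).trans ((lintegral_leftMul hb0 hmW).trans ?_)
  rw [← lintegral_const_mul' _ _ ENNReal.ofReal_ne_top,
    ← lintegral_const_mul' _ _ ENNReal.ofReal_ne_top]
  refine lintegral_congr fun W => ?_
  have hb' : absDet b = nbarVol Y := hdet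
  rw [hb', Fintype.card_fin, div_pow, div_eq_mul_inv,
    ENNReal.ofReal_mul (pow_nonneg (absDet_nonneg W) q), pow_add, mul_inv,
    ENNReal.ofReal_mul (by positivity)]
  ring

end Stack

/-! ### The distribution of the upper left block of a random element of `K` -/

section Average

variable {F : ScalarField} {p q : ℕ}

instance : IsProbabilityMeasure (haarK F p q) := by
  refine ⟨?_⟩
  have h := Measure.haarMeasure_self (K₀ := (⊤ : TopologicalSpace.PositiveCompacts (K F p q)))
  simpa [haarK] using h

instance : (haarK F p q).IsMulLeftInvariant :=
  inferInstanceAs (Measure.haarMeasure ⊤).IsMulLeftInvariant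

/-- The absolute value of the real determinant of the upper left block. -/
def blockDet (x : G F p q) : ℝ := |realDet x.mat.toBlocks₁₁|

theorem continuous_mat : Continuous fun k : K F p q => (k : G F p q).mat :=
  Units.continuous_val.comp (continuous_subtype_val.comp continuous_subtype_val)

@[fun_prop]
theorem continuous_blockDet : Continuous fun k : K F p q => blockDet (k : G F p q) := by
  have h : Continuous fun k : K F p q => (k : G F p q).mat.toBlocks₁₁ :=
    continuous_mat.matrix_submatrix Sum.inl Sum.inl
  exact continuous_abs.comp (continuous_realDet.comp h)

theorem mat_inv_of_mem_K {k : G F p q} (hk : k ∈ K F p q) : k⁻¹.mat = star k.mat :=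
  (Units.eq_inv_of_mul_eq_one_right hk).symm

theorem blockDet_inv {k : G F p q} (hk : k ∈ K F p q) : blockDet k⁻¹ = blockDet k := by
  rw [blockDet, blockDet, mat_inv_of_mem_K hk]
  change |realDet (star k.mat.toBlocks₁₁)| = _
  rw [realDet_star]

theorem blockDet_eq_frame (k : G F p q) (W : Matrix (Fin p) (Fin p) F) :
    (absDet fun i => (frame k.mat * W) (Sum.inl i)) = blockDet k * absDet W := by
  change absDet (k.mat.toBlocks₁₁ * W) = _
  rw [absDet_mul]
  rfl

/-- Replacing `Z` by `k* Z` changes neither weight nor Gram volume, so the integral may be averaged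
over `K`. For almost every fixed `Z`, the inner average over `k` then no longer depends on `Z`. -/
theorem lintegral_blockDet (hp : 1 ≤ p) (hq : 1 ≤ q) {f : ℝ → ℝ≥0∞} (hf : Measurable f) :
    ∫⁻ Z : Fin p ⊕ Fin q → Fin p → F,
        f ((absDet fun i => Z (Sum.inl i)) / gramVol Z) * gaussWeight Z =
      (∫⁻ k : K F p q, f (blockDet (k : G F p q)) ∂haarK F p q) *
        ∫⁻ Z : Fin p ⊕ Fin q → Fin p → F, gaussWeight Z := by
  have hm : Measurable fun Z : Fin p ⊕ Fin q → Fin p → F =>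
      f ((absDet fun i => Z (Sum.inl i)) / gramVol Z) * gaussWeight Z := by
    have := measurable_inl_comp (F := F) (p := p) (q := q) (κ := Fin p)
    fun_prop
  have hinv : ∀ k : K F p q, star (star (k : G F p q).mat) * star (k : G F p q).mat = 1 := by
    intro k
    rw [star_star]
    exact mul_eq_one_comm.1 k.2
  have hav : ∀ k : K F p q, ∫⁻ Z : Fin p ⊕ Fin q → Fin p → F,
      f ((absDet fun i => Z (Sum.inl i)) / gramVol Z) * gaussWeight Z =
      ∫⁻ Z : Fin p ⊕ Fin q → Fin p → F,
        f ((absDet fun i => leftMul (star (k : G F p q).mat) Z (Sum.inl i)) / gramVol Z) *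
          gaussWeight Z := by
    intro k
    rw [← lintegral_comp_of_normSq (L := leftMul (star (k : G F p q).mat))
      (fun Z => normSq_unitary_mul (hinv k) (Matrix.of Z)) hm]
    refine lintegral_congr fun Z => ?_
    rw [gramVol_unitary_mul (hinv k), gaussWeight, leftMul_apply, normSq_unitary_mul (hinv k)]
    rfl
  have hjoint : Measurable fun x : K F p q × (Fin p ⊕ Fin q → Fin p → F) =>
      (leftMul (star (x.1 : G F p q).mat) x.2 : Fin p ⊕ Fin q → Fin p → F) := by
    refine measurable_pi_lambda _ fun i => measurable_pi_lambda _ fun j => ?_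
    simp only [leftMul_apply, Matrix.mul_apply, Matrix.of_apply, Matrix.star_apply]
    refine Finset.measurable_sum _ fun l _ => ?_
    have h1 : Measurable fun k : K F p q => star ((k : G F p q).mat l i) :=
      (continuous_star.comp ((continuous_apply_apply l i).comp continuous_mat)).measurable
    have h2 : Measurable fun Z : Fin p ⊕ Fin q → Fin p → F => Z l j := by fun_prop
    exact (h1.comp measurable_fst).mul (h2.comp measurable_snd)
  calc ∫⁻ Z : Fin p ⊕ Fin q → Fin p → F,
        f ((absDet fun i => Z (Sum.inl i)) / gramVol Z) * gaussWeight Z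
      = ∫⁻ k : K F p q, (∫⁻ Z : Fin p ⊕ Fin q → Fin p → F,
          f ((absDet fun i => leftMul (star (k : G F p q).mat) Z (Sum.inl i)) / gramVol Z) *
            gaussWeight Z) ∂haarK F p q := by
        rw [← lintegral_congr hav, lintegral_const, measure_univ, mul_one]
    _ = ∫⁻ Z : Fin p ⊕ Fin q → Fin p → F, (∫⁻ k : K F p q,
          f ((absDet fun i => leftMul (star (k : G F p q).mat) Z (Sum.inl i)) / gramVol Z) *
            gaussWeight Z ∂haarK F p q) := by
        refine lintegral_lintegral_swap ?_
        have h1 := (measurable_inl_comp (F := F) (p := p) (q := q) (κ := Fin p)).comp hjoint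
        have h2 : Measurable fun x : K F p q × (Fin p ⊕ Fin q → Fin p → F) =>
            absDet fun i => (leftMul (star (x.1 : G F p q).mat) x.2 :
              Fin p ⊕ Fin q → Fin p → F) (Sum.inl i) := continuous_absDet.measurable.comp h1
        have h3 : Measurable fun x : K F p q × (Fin p ⊕ Fin q → Fin p → F) => gramVol x.2 :=
          continuous_gramVol.measurable.comp measurable_snd
        have h4 : Measurable fun x : K F p q × (Fin p ⊕ Fin q → Fin p → F) => gaussWeight x.2 :=
          measurable_gaussWeight.comp measurable_snd
        exact ((hf.comp (h2.div h3)).mul h4).aemeasurable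
    _ = ∫⁻ Z : Fin p ⊕ Fin q → Fin p → F,
          (∫⁻ k : K F p q, f (blockDet (k : G F p q)) ∂haarK F p q) * gaussWeight Z := by
        refine lintegral_congr_ae ?_
        have hae : ∀ᵐ Z : Fin p ⊕ Fin q → Fin p → F, absDet (fun i => Z (Sum.inl i)) ≠ 0 := by
          have hs : MeasurableSet {Z : Fin p ⊕ Fin q → Fin p → F |
              ¬ absDet (fun i => Z (Sum.inl i)) ≠ 0} := by
            have := measurable_inl_comp (F := F) (p := p) (q := q) (κ := Fin p)
            exact (measurableSet_eq_fun (by fun_prop) measurable_const).compl.compl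
          rw [ae_iff, ← lintegral_indicator_one hs, lintegral_stack (measurable_one.indicator hs),
            lintegral_congr_ae (g := 0), lintegral_zero_fun]
          filter_upwards [ae_absDet_ne_zero p] with Z₁ hZ₁
          simp [Set.indicator, hZ₁]
        filter_upwards [hae] with Z hZ
        rw [lintegral_mul_const' _ _ (gaussWeight_ne_top Z)]
        congr 1
        set Z₁ : Matrix (Fin p) (Fin p) F := Matrix.of fun i => Z (Sum.inl i) with hZ₁
        obtain ⟨u, hu⟩ := isUnit_of_realDet_ne_zero (x := Z₁) (abs_ne_zero.1 hZ)
        let Z₂ : Matrix (Fin q) (Fin p) F := Matrix.of fun i => Z (Sum.inr i)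
        obtain ⟨hpos, k₀, hk₀, b, hb, hdet⟩ := exists_frame_nbarMat hp hq (Z₂ * u⁻¹.val)
        have hfr : Matrix.of Z = frame k₀.mat * (b * Z₁) := by
          rw [← Matrix.mul_assoc, ← hb, ← hu]
          refine Eq.trans ?_ (frame_nbarMat_mul (Z₂ * u⁻¹.val) u.val).symm
          funext i
          rcases i with i | i
          · change Z₁ i = u.val i
            rw [hu]
          · change Z₂ i = (Z₂ * u⁻¹.val * u.val) i
            rw [Matrix.mul_assoc, Units.inv_mul, Matrix.mul_one]
        have hW : absDet (b * Z₁) ≠ 0 := by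
          rw [absDet_mul]
          refine mul_ne_zero ?_ hZ
          change |realDet b| ≠ 0
          rw [hdet]
          exact hpos.ne'
        have hgram : gramVol Z = absDet (b * Z₁) := by
          rw [← gramVol_isometry_mul (frame_conjTranspose_mul hk₀), ← hfr]
          rfl
        -- The ratio is the block determinant of `k⁻¹ k₀`. Inversion is the adjoint on `K` and
        -- preserves it, so it becomes a left translate in `k`, to which invariance of `dk` applies.
        have hratio : ∀ k : K F p q,
            (absDet fun i => leftMul (star (k : G F p q).mat) Z (Sum.inl i)) / gramVol Z =
              blockDet ((⟨k₀, hk₀⟩⁻¹ * k : K F p q) : G F p q) := by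
          intro k
          rw [hgram, leftMul_apply, hfr, ← Matrix.mul_assoc, ← mat_inv_of_mem_K k.2, ← frame_mul,
            ← G.mat_mul, blockDet_eq_frame, mul_div_cancel_right₀ _ hW,
            ← blockDet_inv ((⟨k₀, hk₀⟩⁻¹ * k : K F p q)).2]
          simp
        simp only [hratio]
        exact lintegral_mul_left_eq_self (fun k : K F p q => f (blockDet (k : G F p q))) _
    _ = _ := by
        rw [lintegral_const_mul _ (by fun_prop)]

/-- The mass of the density `a_P(n̄)^{-2ρ}`, for the unnormalized Lebesgue measure. -/
def nbarMass (F : ScalarField) (p q : ℕ) : ℝ≥0∞ :=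
  ∫⁻ Y : Fin q → Fin p → F, ENNReal.ofReal (nbarVol Y ^ (p + q))⁻¹

/-- The Gaussian integral of `|det|^q`. -/
def detMass (F : ScalarField) (p q : ℕ) : ℝ≥0∞ :=
  ∫⁻ W : Fin p → Fin p → F, ENNReal.ofReal (absDet W ^ q) * gaussWeight W

theorem lintegral_blockDet_eq (hp : 1 ≤ p) (hq : 1 ≤ q) {f : ℝ → ℝ≥0∞} (hf : Measurable f) :
    (∫⁻ k : K F p q, f (blockDet (k : G F p q)) ∂haarK F p q) *
        ∫⁻ Z : Fin p ⊕ Fin q → Fin p → F, gaussWeight Z =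
      (∫⁻ Y : Fin q → Fin p → F,
        ENNReal.ofReal (nbarVol Y ^ (p + q))⁻¹ * f (nbarVol Y)⁻¹) * detMass F p q := by
  have hf' : Measurable fun x : ℝ × ℝ => f (x.1 / x.2) := by fun_prop
  rw [← lintegral_blockDet hp hq hf, lintegral_gram hp hq hf',
    ← lintegral_mul_const _ (by fun_prop)]
  refine lintegral_congr fun Y => ?_
  rw [mul_assoc, detMass]
  congr 1
  rw [← lintegral_const_mul _ (by fun_prop)]
  refine lintegral_congr_ae ?_
  filter_upwards [ae_absDet_ne_zero p] with W hW
  rw [div_right_comm, div_self hW, one_div, mul_assoc]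

/-- The case `f = 1`. A product equal to a finite nonzero Gaussian integral has finite nonzero
factors; in particular `a_P(n̄)^(-2ρ)` is integrable. -/
theorem nbarMass_mul_detMass (hp : 1 ≤ p) (hq : 1 ≤ q) :
    nbarMass F p q * detMass F p q = ∫⁻ Z : Fin p ⊕ Fin q → Fin p → F, gaussWeight Z := by
  have h := lintegral_blockDet_eq (F := F) hp hq (f := fun _ => 1) measurable_const
  simpa [nbarMass] using h.symm

theorem nbarMass_ne_zero (hp : 1 ≤ p) (hq : 1 ≤ q) : nbarMass F p q ≠ 0 := by
  intro h
  have := nbarMass_mul_detMass (F := F) hp hq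
  rw [h, zero_mul] at this
  exact lintegral_gaussWeight_ne_zero this.symm

theorem detMass_ne_zero (hp : 1 ≤ p) (hq : 1 ≤ q) : detMass F p q ≠ 0 := by
  intro h
  have := nbarMass_mul_detMass (F := F) hp hq
  rw [h, mul_zero] at this
  exact lintegral_gaussWeight_ne_zero this.symm

theorem nbarMass_ne_top (hp : 1 ≤ p) (hq : 1 ≤ q) : nbarMass F p q ≠ ∞ := by
  intro h
  have := nbarMass_mul_detMass (F := F) hp hq
  rw [h, ENNReal.top_mul (detMass_ne_zero hp hq)] at this
  exact lintegral_gaussWeight_ne_top this.symm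

theorem detMass_ne_top (hp : 1 ≤ p) (hq : 1 ≤ q) : detMass F p q ≠ ∞ := by
  intro h
  have := nbarMass_mul_detMass (F := F) hp hq
  rw [h, ENNReal.mul_top (nbarMass_ne_zero hp hq)] at this
  exact lintegral_gaussWeight_ne_top this.symm

end Average

/-! ### The distribution of `a_P` on `N̄` -/

section Laws

variable {F : ScalarField} {p q : ℕ}

theorem two_mul_rho_div (F : ScalarField) (p q : ℕ) :
    (2 * (rho F p q : ℂ)) / F.d = ((p + q : ℕ) : ℂ) := by
  have hd : (F.d : ℂ) ≠ 0 := by exact_mod_cast (d_pos F).ne'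
  rw [rho]
  push_cast
  field_simp

theorem enorm_iwasawaPow_two_rho (hp : 1 ≤ p) (hq : 1 ≤ q) (Y : Fin q → Fin p → F) :
    ‖iwasawaPow (nbar (Matrix.of Y)) (-(2 * rho F p q))‖ₑ =
      ENNReal.ofReal (nbarVol Y ^ (p + q))⁻¹ := by
  have hpos := nbarVol_pos hp hq Y
  rw [iwasawaPow_nbar hp hq, neg_div, two_mul_rho_div, Complex.cpow_neg, Complex.cpow_natCast,
    ← Complex.ofReal_pow, ← Complex.ofReal_inv, ← ofReal_norm, Complex.norm_real,
    Real.norm_of_nonneg (by positivity)]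

/-- The chosen Haar measure and the product measure `volume` differ by a scalar, which the
normalization cancels. -/
theorem haarNbar_eq (hp : 1 ≤ p) (hq : 1 ≤ q) :
    haarNbar F p q = (nbarMass F p q)⁻¹ • (volume : Measure (Fin q → Fin p → F)) := by
  have ha := Measure.isAddLeftInvariant_eq_smul
    (Measure.addHaar : Measure (Fin q → Fin p → F)) volume
  have ha0 := Measure.addHaarScalarFactor_pos_of_isAddHaarMeasure
    (Measure.addHaar : Measure (Fin q → Fin p → F)) volume
  set a := Measure.addHaarScalarFactor (Measure.addHaar : Measure (Fin q → Fin p → F)) volume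
  have ha1 : (a : ℝ≥0∞) ≠ 0 := by exact_mod_cast ha0.ne'
  have ha2 : (Measure.addHaar : Measure (Fin q → Fin p → F)) = (a : ℝ≥0∞) • volume := ha
  rw [haarNbar, lintegral_congr (enorm_iwasawaPow_two_rho hp hq), ha2, lintegral_smul_measure,
    smul_smul, smul_eq_mul, ENNReal.mul_inv (Or.inl ha1) (Or.inl ENNReal.coe_ne_top),
    mul_right_comm, ENNReal.inv_mul_cancel ha1 ENNReal.coe_ne_top, one_mul]
  rfl

/-- The probability measure `a_P(n̄)^{-2ρ} dn̄` on `N̄`. -/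
def nbarLaw (F : ScalarField) (p q : ℕ) : Measure (Fin q → Fin p → F) :=
  (haarNbar F p q).withDensity fun Y => ENNReal.ofReal (nbarVol Y ^ (p + q))⁻¹

theorem lintegral_nbarLaw (hp : 1 ≤ p) (hq : 1 ≤ q) {f : (Fin q → Fin p → F) → ℝ≥0∞}
    (hf : Measurable f) : ∫⁻ Y, f Y ∂nbarLaw F p q =
      (nbarMass F p q)⁻¹ * ∫⁻ Y, ENNReal.ofReal (nbarVol Y ^ (p + q))⁻¹ * f Y := by
  rw [nbarLaw, lintegral_withDensity_eq_lintegral_mul _ (by fun_prop) hf, haarNbar_eq hp hq,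
    lintegral_smul_measure, smul_eq_mul]
  rfl

theorem isProbabilityMeasure_nbarLaw (hp : 1 ≤ p) (hq : 1 ≤ q) :
    IsProbabilityMeasure (nbarLaw F p q) := by
  refine ⟨?_⟩
  rw [← setLIntegral_one, setLIntegral_univ, lintegral_nbarLaw hp hq measurable_const]
  simp only [mul_one]
  exact ENNReal.inv_mul_cancel (nbarMass_ne_zero hp hq) (nbarMass_ne_top hp hq)

/-- This equality of laws is the reason why `J(λ)1 = c_P(λ)`: both are the same moment of it. -/
theorem map_blockDet (hp : 1 ≤ p) (hq : 1 ≤ q) :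
    (haarK F p q).map (fun k : K F p q => blockDet (k : G F p q)) =
      (nbarLaw F p q).map fun Y => (nbarVol Y)⁻¹ := by
  refine Measure.ext_of_lintegral _ fun f hf => ?_
  rw [lintegral_map hf continuous_blockDet.measurable, lintegral_map hf (by fun_prop),
    lintegral_nbarLaw hp hq (by fun_prop)]
  have h := lintegral_blockDet_eq (F := F) hp hq hf
  rw [← nbarMass_mul_detMass hp hq, ← mul_assoc,
    ENNReal.mul_left_inj (detMass_ne_zero hp hq) (detMass_ne_top hp hq)] at h
  rw [← h, mul_comm _ (nbarMass F p q), ← mul_assoc,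
    ENNReal.inv_mul_cancel (nbarMass_ne_zero hp hq) (nbarMass_ne_top hp hq), one_mul]

/-- The Gaussian measure on square matrices with density `|det|^q`. -/
def detLaw (F : ScalarField) (p q : ℕ) : Measure (Fin p → Fin p → F) :=
  (gaussMat F (Fin p) (Fin p)).withDensity fun W => ENNReal.ofReal (absDet W ^ q)

theorem lintegral_detLaw {f : (Fin p → Fin p → F) → ℝ≥0∞} (hf : Measurable f) :
    ∫⁻ W, f W ∂detLaw F p q = ∫⁻ W, f W * ENNReal.ofReal (absDet W ^ q) * gaussWeight W := by
  rw [detLaw, lintegral_withDensity_eq_lintegral_mul _ (by fun_prop) hf,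
    lintegral_gaussMat (by fun_prop)]
  simp only [Pi.mul_apply, mul_comm (f _)]

theorem detLaw_univ : detLaw F p q Set.univ = detMass F p q := by
  rw [← setLIntegral_one, setLIntegral_univ, lintegral_detLaw measurable_const]
  simp [detMass]

theorem isFiniteMeasure_detLaw (hp : 1 ≤ p) (hq : 1 ≤ q) : IsFiniteMeasure (detLaw F p q) :=
  ⟨by rw [detLaw_univ]; exact (detMass_ne_top hp hq).lt_top⟩

/-- `lintegral_gram` for functions of `|det Z₁|` alone: up to masses, this variable is a product of
independent ones, so its moments are products. -/
theorem map_absDet_gaussMat (hp : 1 ≤ p) (hq : 1 ≤ q) :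
    gaussMat F (Fin q) (Fin p) Set.univ • (gaussMat F (Fin p) (Fin p)).map absDet =
      nbarMass F p q • ((nbarLaw F p q).prod (detLaw F p q)).map
        fun x => (nbarVol x.1)⁻¹ * absDet x.2 := by
  have := isFiniteMeasure_detLaw (F := F) hp hq
  refine Measure.ext_of_lintegral _ fun f hf => ?_
  have hf' : Measurable fun x : ℝ × ℝ => f x.1 := by fun_prop
  have hm : Measurable fun Z : Fin p ⊕ Fin q → Fin p → F =>
      f (absDet fun i => Z (Sum.inl i)) * gaussWeight Z := by
    have := measurable_inl_comp (F := F) (p := p) (q := q) (κ := Fin p)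
    fun_prop
  have h := lintegral_gram (F := F) hp hq hf'
  rw [lintegral_stack hm] at h
  have hw : ∀ (Z₁ : Fin p → Fin p → F) (Z₂ : Fin q → Fin p → F),
      gaussWeight (Sum.elim Z₁ Z₂) = gaussWeight Z₁ * gaussWeight Z₂ := by
    intro Z₁ Z₂
    rw [gaussWeight, gaussWeight, gaussWeight, ← ENNReal.ofReal_mul (Real.exp_pos _).le,
      ← Real.exp_add]
    simp [normSq, add_comm]
  rw [lintegral_smul_measure, lintegral_map hf (by fun_prop), lintegral_gaussMat (by fun_prop),
    lintegral_smul_measure, lintegral_map hf (by fun_prop), lintegral_prod _ (by fun_prop),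
    lintegral_nbarLaw hp hq (by fun_prop), smul_eq_mul, smul_eq_mul, ← mul_assoc,
    ENNReal.mul_inv_cancel (nbarMass_ne_zero hp hq) (nbarMass_ne_top hp hq), one_mul,
    ← setLIntegral_one, setLIntegral_univ, lintegral_gaussMat (by fun_prop),
    ← lintegral_const_mul _ (by fun_prop)]
  refine Eq.trans (lintegral_congr fun Z₁ => ?_) (h.trans (lintegral_congr fun Y => ?_))
  · simp only [hw, one_mul]
    rw [← lintegral_mul_const _ (by fun_prop)]
    refine lintegral_congr fun Z₂ => ?_
    simp only [Sum.elim_inl]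
    ring
  · rw [lintegral_detLaw (by fun_prop)]
    simp only [div_eq_inv_mul]

end Laws

/-! ### The moments of `a_P` and the Gamma quotient -/

section Final

variable {F : ScalarField} {p q : ℕ}

theorem integral_detLaw (s : ℂ) :
    ∫ W, (absDet W : ℂ) ^ s ∂detLaw F p q =
      ∫ W, (absDet W : ℂ) ^ (s + q) ∂gaussMat F (Fin p) (Fin p) := by
  rw [detLaw, integral_withDensity_eq_integral_toReal_smul (by fun_prop) (by simp)]
  refine integral_congr_ae ?_
  have h : ∀ᵐ W ∂gaussMat F (Fin p) (Fin p), absDet W ≠ 0 :=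
    (withDensity_absolutelyContinuous _ _) (ae_absDet_ne_zero p)
  filter_upwards [h] with W hW
  rw [ENNReal.toReal_ofReal (pow_nonneg (absDet_nonneg W) q),
    Complex.cpow_add _ _ (Complex.ofReal_ne_zero.2 hW), Complex.cpow_natCast, Complex.real_smul,
    Complex.ofReal_pow, mul_comm]

theorem nbarLaw_moment (hp : 1 ≤ p) (hq : 1 ≤ q) {s : ℂ} (hs : -1 < s.re) :
    Integrable (fun Y => (((nbarVol Y)⁻¹ : ℝ) : ℂ) ^ s) (nbarLaw F p q) ∧
    ∫ Y, (((nbarVol Y)⁻¹ : ℝ) : ℂ) ^ s ∂nbarLaw F p q =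
      (∏ j : Fin p, Complex.Gamma ((F.d * (p - (j : ℕ)) + F.d * q) / 2)) /
        (∏ j : Fin p, Complex.Gamma ((F.d * (p - (j : ℕ))) / 2)) *
      ((∏ j : Fin p, Complex.Gamma ((F.d * (p - (j : ℕ)) + F.d * s) / 2)) /
        ∏ j : Fin p, Complex.Gamma ((F.d * (p - (j : ℕ)) + F.d * (s + q)) / 2)) := by
  have := isFiniteMeasure_detLaw (F := F) hp hq
  have := isProbabilityMeasure_nbarLaw (F := F) hp hq
  obtain ⟨C, hC, hmom⟩ := gaussMat_moment (F := F) p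
  have hlaw := map_absDet_gaussMat (F := F) hp hq
  set g := gaussMat F (Fin q) (Fin p) Set.univ with hg
  have hg0 : g ≠ 0 := NeZero.ne _
  have hgt : g ≠ ∞ := measure_ne_top _ _
  have hpow : ∀ (s : ℂ) (x : (Fin q → Fin p → F) × (Fin p → Fin p → F)),
      (((nbarVol x.1)⁻¹ * absDet x.2 : ℝ) : ℂ) ^ s =
        (((nbarVol x.1)⁻¹ : ℝ) : ℂ) ^ s * (absDet x.2 : ℂ) ^ s := by
    intro s x
    rw [Complex.ofReal_mul, Complex.mul_cpow_ofReal_nonneg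
      (inv_nonneg.2 (nbarVol_pos hp hq x.1).le) (absDet_nonneg _)]
  have hm : ∀ s : ℂ, Measurable fun x : ℝ => (x : ℂ) ^ s := fun s => by fun_prop
  have key : ∀ s : ℂ, -1 < s.re →
      g.toReal * (C * ∏ j : Fin p, Complex.Gamma ((F.d * (p - (j : ℕ)) + F.d * s) / 2)) =
      (nbarMass F p q).toReal * ((∫ Y, (((nbarVol Y)⁻¹ : ℝ) : ℂ) ^ s ∂nbarLaw F p q) *
        (C * ∏ j : Fin p, Complex.Gamma ((F.d * (p - (j : ℕ)) + F.d * (s + q)) / 2))) := by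
    intro s hs
    have hsq : -1 < (s + q).re := by
      have : (0 : ℝ) ≤ q := Nat.cast_nonneg q
      simp
      linarith
    have h := congrArg (fun μ => ∫ x : ℝ, (x : ℂ) ^ s ∂μ) hlaw
    simp only [integral_smul_measure] at h
    rw [integral_map (by fun_prop) (hm s).aestronglyMeasurable,
      integral_map (by fun_prop) (hm s).aestronglyMeasurable] at h
    simp only [hpow] at h
    rw [integral_prod_mul (f := fun Y => (((nbarVol Y)⁻¹ : ℝ) : ℂ) ^ s)
      (g := fun W => (absDet W : ℂ) ^ s), integral_detLaw, (hmom s hs).2, (hmom _ hsq).2] at h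
    simpa only [Complex.real_smul] using h
  have hG : ∀ s : ℂ, -1 < s.re →
      ∏ j : Fin p, Complex.Gamma ((F.d * (p - (j : ℕ)) + F.d * s) / 2) ≠ 0 := by
    intro s hs
    refine Finset.prod_ne_zero_iff.2 fun j _ => Complex.Gamma_ne_zero_of_re_pos ?_
    have hj : ((j : ℕ) : ℝ) + 1 ≤ p := by exact_mod_cast j.2
    have hd : (0 : ℝ) < F.d := by exact_mod_cast d_pos F
    have : (((F.d : ℂ) * (p - (j : ℕ)) + F.d * s) / 2).re = F.d * (p - (j : ℕ) + s.re) / 2 := by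
      rw [show ((2 : ℂ)) = ((2 : ℝ) : ℂ) by simp, Complex.div_ofReal_re]
      simp
      ring
    rw [this]
    have : (0 : ℝ) < p - (j : ℕ) + s.re := by linarith
    positivity
  constructor
  · have h : Integrable (fun x : ℝ => (x : ℂ) ^ s)
        (g • (gaussMat F (Fin p) (Fin p)).map absDet) :=
      ((integrable_map_measure (hm s).aestronglyMeasurable (by fun_prop)).2
        (hmom s hs).1).smul_measure hgt
    rw [hlaw, integrable_smul_measure (nbarMass_ne_zero hp hq) (nbarMass_ne_top hp hq),
      integrable_map_measure (hm s).aestronglyMeasurable (by fun_prop)] at h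
    simp only [Function.comp_def, hpow] at h
    have h0 : ∀ᵐ W ∂detLaw F p q, absDet W ≠ 0 :=
      ((withDensity_absolutelyContinuous _ _).trans (withDensity_absolutelyContinuous _ _))
        (ae_absDet_ne_zero p)
    have hne : NeZero (detLaw F p q) := ⟨fun h => detMass_ne_zero (F := F) hp hq (by
      rw [← detLaw_univ, h]; simp)⟩
    -- By Fubini almost every section in `Y` is integrable. A section with `det W ≠ 0` is the wanted
    -- function times the nonzero constant `|det W|^s`.
    obtain ⟨W, hW, hW0⟩ := (h.prod_left_ae.and h0).exists
    simpa [mul_assoc, Complex.cpow_eq_zero_iff, hW0] using hW.mul_const ((absDet W : ℂ) ^ s)⁻¹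
  -- Since `nbarLaw` has mass one, `s = 0` determines the ratio of the two masses in `key`, which is
  -- then eliminated from the identity at `s`.
  · have h0 := key 0 (by simp)
    have h1 := key s hs
    simp only [Complex.cpow_zero, integral_const, probReal_univ, one_smul, mul_zero, add_zero,
      zero_add, one_mul] at h0
    have hG0 := hG 0 (by simp)
    simp only [mul_zero, add_zero] at hG0
    have hGq := hG (s + q) (by
      have : (0 : ℝ) ≤ q := Nat.cast_nonneg q
      simp
      linarith)
    have hCc : (C : ℂ) ≠ 0 := by exact_mod_cast hC.ne'
    have hmass : ((nbarMass F p q).toReal : ℂ) ≠ 0 := by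
      exact_mod_cast (ENNReal.toReal_pos (nbarMass_ne_zero hp hq) (nbarMass_ne_top hp hq)).ne'
    have hgc : (g.toReal : ℂ) ≠ 0 := by exact_mod_cast (ENNReal.toReal_pos hg0 hgt).ne'
    generalize (∏ j : Fin p, Complex.Gamma ((F.d * (p - (j : ℕ)) + F.d * (s + q)) / 2)) = Gsq at *
    generalize (∏ j : Fin p, Complex.Gamma ((F.d * (p - (j : ℕ)) + F.d * s) / 2)) = Gs at *
    generalize (∏ j : Fin p, Complex.Gamma ((F.d * (p - (j : ℕ)) + F.d * q) / 2)) = Gq at *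
    generalize (∏ j : Fin p, Complex.Gamma ((F.d * (p - (j : ℕ))) / 2)) = G0 at *
    generalize (∫ Y, (((nbarVol Y)⁻¹ : ℝ) : ℂ) ^ s ∂nbarLaw F p q) = I at *
    have h0' : (g.toReal : ℂ) * G0 = (nbarMass F p q).toReal * Gq :=
      mul_left_cancel₀ hCc (by linear_combination h0)
    have h1' : (g.toReal : ℂ) * Gs = (nbarMass F p q).toReal * (I * Gsq) :=
      mul_left_cancel₀ hCc (by linear_combination h1)
    field_simp
    refine mul_left_cancel₀ (mul_ne_zero hmass hgc) ?_
    linear_combination (-(g.toReal : ℂ) * G0) * h1' + (g.toReal : ℂ) * Gs * h0'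

/-- Put `s = (λ - ρ)/d`; then `d(p + s) = λ - ρ + dp`, and `2ρ = d(p + q)` gives `d(p + s + q) = λ +
ρ`. -/
theorem gammaQuotient_eq (lam : ℂ) :
    gammaQuotient F p q lam =
      (∏ j : Fin p, Complex.Gamma ((F.d * (p - (j : ℕ)) + F.d * q) / 2)) /
        (∏ j : Fin p, Complex.Gamma ((F.d * (p - (j : ℕ))) / 2)) *
      ((∏ j : Fin p, Complex.Gamma
          ((F.d * (p - (j : ℕ)) + F.d * ((lam - rho F p q) / F.d)) / 2)) /
        ∏ j : Fin p, Complex.Gamma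
          ((F.d * (p - (j : ℕ)) + F.d * ((lam - rho F p q) / F.d + q)) / 2)) := by
  have hd : (F.d : ℂ) ≠ 0 := by exact_mod_cast (d_pos F).ne'
  have hrho : (rho F p q : ℂ) = F.d * (p + q) / 2 := by simp [rho]
  simp only [gammaQuotient, siegelGamma]
  congr 2
  · refine Finset.prod_congr rfl fun j _ => congrArg _ (by ring)
  · refine Finset.prod_congr rfl fun j _ => congrArg _ (by ring)
  · refine Finset.prod_congr rfl fun j _ => congrArg _ ?_
    rw [mul_div_cancel₀ _ hd]
    ring
  · refine Finset.prod_congr rfl fun j _ => congrArg _ ?_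
    rw [mul_add, mul_div_cancel₀ _ hd, hrho]
    ring

theorem meromorphic_siegelGamma (p d : ℕ) (a : ℂ) :
    Meromorphic fun lam : ℂ => siegelGamma p d fun _ => (lam + a) / 2 := by
  intro x
  simp only [siegelGamma]
  refine MeromorphicAt.fun_prod fun j _ => ?_
  exact (Meromorphic.Gamma _).comp_analyticAt (f := Complex.Gamma) (x := x)
    (g := fun lam => (lam + a) / 2 - (d : ℂ) / 2 * (j : ℕ)) (by fun_prop)

theorem meromorphic_gammaQuotient : Meromorphic (gammaQuotient F p q) := by
  intro x
  have h₁ := meromorphic_siegelGamma p F.d (-rho F p q + F.d * p) x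
  have h₂ := meromorphic_siegelGamma p F.d (rho F p q) x
  have h := (MeromorphicAt.const (siegelGamma p F.d (fun _ => (F.d : ℂ) * ((p : ℂ) + q) / 2) /
    siegelGamma p F.d (fun _ => (F.d : ℂ) * p / 2)) x).mul (h₁.div h₂)
  refine h.congr (Filter.Eventually.of_forall fun lam => ?_)
  simp only [gammaQuotient, Pi.mul_apply, Pi.div_apply, sub_eq_add_neg, add_assoc]

/-- From `-λ - ρ = -2ρ - (λ - ρ)`: the first part is the density of `nbarLaw`, the second a moment
of `1/v`. -/
theorem rho_exponent (lam : ℂ) {v : ℝ} (hv : 0 < v) :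
    (v : ℂ) ^ ((-lam - rho F p q) / F.d) =
      ((v ^ (p + q))⁻¹ : ℝ) • ((v⁻¹ : ℝ) : ℂ) ^ ((lam - rho F p q) / F.d) := by
  have hv' : (v : ℂ) ≠ 0 := Complex.ofReal_ne_zero.2 hv.ne'
  have h : (-lam - rho F p q) / F.d =
      -((p + q : ℕ) : ℂ) + -((lam - rho F p q) / F.d) := by
    rw [← two_mul_rho_div F p q]
    ring
  rw [h, Complex.cpow_add _ _ hv', Complex.cpow_neg, Complex.cpow_natCast, Complex.cpow_neg,
    Complex.ofReal_inv, Complex.inv_cpow _ _ (by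
      rw [Complex.arg_ofReal_of_nonneg hv.le]
      exact Real.pi_pos.ne), Complex.real_smul, Complex.ofReal_inv, Complex.ofReal_pow]

theorem neg_one_lt_re_exponent {lam : ℂ} (hlam : rho F p q - F.d < lam.re) :
    -1 < ((lam - rho F p q) / F.d).re := by
  have hd : (0 : ℝ) < F.d := by exact_mod_cast d_pos F
  rw [← Complex.ofReal_natCast, Complex.div_ofReal_re, Complex.sub_re, Complex.ofReal_re,
    lt_div_iff₀ hd]
  linarith

theorem iwasawaPow_integral (hp : 1 ≤ p) (hq : 1 ≤ q) {lam : ℂ}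
    (hlam : rho F p q - F.d < lam.re) :
    Integrable (fun Y : Fin q → Fin p → F =>
      iwasawaPow (nbar (Matrix.of Y)) (-lam - rho F p q)) (haarNbar F p q) ∧
    ∫ Y : Fin q → Fin p → F, iwasawaPow (nbar (Matrix.of Y)) (-lam - rho F p q) ∂haarNbar F p q =
      gammaQuotient F p q lam := by
  have h := nbarLaw_moment (F := F) hp hq (neg_one_lt_re_exponent hlam)
  rw [← gammaQuotient_eq, nbarLaw,
    integrable_withDensity_iff_integrable_smul' (by fun_prop) (by simp),
    integral_withDensity_eq_integral_toReal_smul (by fun_prop) (by simp)] at h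
  convert h using 4 with Y Y
  all_goals
    have hv := nbarVol_pos hp hq Y
    rw [iwasawaPow_nbar hp hq, rho_exponent lam hv, ENNReal.toReal_ofReal (by positivity)]

theorem ae_blockDet_ne_zero (hp : 1 ≤ p) (hq : 1 ≤ q) :
    ∀ᵐ k : K F p q ∂haarK F p q, blockDet (k : G F p q) ≠ 0 := by
  have h : ∀ᵐ x ∂(haarK F p q).map (fun k : K F p q => blockDet (k : G F p q)), x ≠ 0 := by
    rw [map_blockDet hp hq]
    refine (ae_map_iff (by fun_prop) (measurableSet_singleton 0).compl).2 ?_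
    exact Filter.Eventually.of_forall fun Y => inv_ne_zero (nbarVol_pos hp hq Y).ne'
  exact ae_of_ae_map continuous_blockDet.measurable.aemeasurable h

theorem alphaPow_integral (hp : 1 ≤ p) (hq : 1 ≤ q) {lam : ℂ}
    (hlam : rho F p q - F.d < lam.re) :
    Integrable (fun k : K F p q => alphaPow (k : G F p q) (lam - rho F p q)) (haarK F p q) ∧
    cP F p q lam = gammaQuotient F p q lam := by
  have h := nbarLaw_moment (F := F) hp hq (neg_one_lt_re_exponent hlam)
  have hm : Measurable fun x : ℝ => (x : ℂ) ^ ((lam - rho F p q) / F.d) := by fun_prop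
  -- The determinant formula for `alphaPow` is available where the upper left block is invertible,
  -- which is almost everywhere on `K`.
  have hae : (fun k : K F p q => alphaPow (k : G F p q) (lam - rho F p q)) =ᵐ[haarK F p q]
      fun k => (blockDet (k : G F p q) : ℂ) ^ ((lam - rho F p q) / F.d) := by
    filter_upwards [ae_blockDet_ne_zero hp hq] with k hk
    exact alphaPow_eq hp hq (abs_ne_zero.1 hk) _
  have hb := (continuous_blockDet (F := F) (p := p) (q := q)).measurable.aemeasurable
    (μ := haarK F p q)
  constructor
  · refine Integrable.congr ?_ hae.symm
    have hi := (integrable_map_measure (μ := nbarLaw F p q) hm.aestronglyMeasurable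
      (f := fun Y => (nbarVol Y)⁻¹) (by fun_prop)).2 h.1
    rw [← map_blockDet hp hq] at hi
    exact (integrable_map_measure hm.aestronglyMeasurable hb).1 hi
  · rw [cP, integral_congr_ae hae, ← integral_map hb hm.aestronglyMeasurable,
      map_blockDet hp hq, integral_map (by fun_prop) hm.aestronglyMeasurable, h.2,
      gammaQuotient_eq]

theorem J_const (hp : 1 ≤ p) (hq : 1 ≤ q) {lam : ℂ} (hlam : rho F p q - F.d < lam.re)
    (w : ℂ) (k : K F p q) : J F p q lam (fun _ => w) k = cP F p q lam * w := by
  rw [J, integral_mul_const, (iwasawaPow_integral hp hq hlam).2, (alphaPow_integral hp hq hlam).2]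

/-- Meromorphic functions that agree on a right half-plane agree off a closed discrete set. -/
theorem eventuallyEq_codiscrete_of_eqOn_halfPlane {f g : ℂ → ℂ} (hf : Meromorphic f)
    (hg : Meromorphic g) {R : ℝ} (h : ∀ z : ℂ, R < z.re → f z = g z) :
    f =ᶠ[Filter.codiscrete ℂ] g := by
  have hfg : Meromorphic (f - g) := fun x => (hf x).sub (hg x)
  have htop : meromorphicOrderAt (f - g) ((R + 1 : ℝ) : ℂ) = ⊤ := by
    rw [meromorphicOrderAt_eq_top_iff]
    have hopen : IsOpen {z : ℂ | R < z.re} := isOpen_lt continuous_const Complex.continuous_re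
    filter_upwards [mem_nhdsWithin_of_mem_nhds (hopen.mem_nhds
      (show R < ((R + 1 : ℝ) : ℂ).re by simp))] with z hz
    exact sub_eq_zero.2 (h z hz)
  -- Identity theorem: on the connected plane, infinite order at one point forces infinite order
  -- everywhere.
  have hall : ∀ z, meromorphicOrderAt (f - g) z = ⊤ := by
    intro z
    by_contra hz
    exact hfg.exists_meromorphicOrderAt_ne_top_iff_forall.1 ⟨z, hz⟩ _ htop
  rw [Filter.EventuallyEq, Filter.Eventually, Filter.codiscrete,
    mem_codiscreteWithin_iff_forall_mem_nhdsNE]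
  intro x _
  filter_upwards [meromorphicOrderAt_eq_top_iff.1 (hall x)] with z hz
  exact Or.inl (sub_eq_zero.1 hz)

end Final

end CosLambda
end

theorem mainTheorem5 (F : CosLambda.ScalarField) (p q : ℕ) (hp : 1 ≤ p) (hpq : p ≤ q) :
    -- the integrals converge for `Re λ > ρ - d` and have the stated value
    (∀ lam : ℂ, CosLambda.rho F p q - F.d < lam.re →
      MeasureTheory.Integrable
        (fun k : CosLambda.K F p q =>
          CosLambda.alphaPow (k : CosLambda.G F p q) (lam - CosLambda.rho F p q))
        (CosLambda.haarK F p q) ∧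
      CosLambda.cP F p q lam = CosLambda.gammaQuotient F p q lam ∧
      MeasureTheory.Integrable
        (fun Y : Fin q → Fin p → F =>
          CosLambda.iwasawaPow (CosLambda.nbar (Matrix.of Y)) (-lam - CosLambda.rho F p q))
        (CosLambda.haarNbar F p q) ∧
      ∀ (w : ℂ) (k : CosLambda.K F p q),
        CosLambda.J F p q lam (fun _ => w) k = CosLambda.cP F p q lam * w) ∧
    -- the right-hand side is meromorphic, and it is the meromorphic continuation of `c_P`
    Meromorphic (CosLambda.gammaQuotient F p q) ∧
    ∀ c : ℂ → ℂ, Meromorphic c →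
      (∃ R : ℝ, ∀ lam : ℂ, R < lam.re → c lam = CosLambda.cP F p q lam) →
      c =ᶠ[Filter.codiscrete ℂ] CosLambda.gammaQuotient F p q := by
  have hq : 1 ≤ q := hp.trans hpq
  refine ⟨fun lam hlam => ⟨(CosLambda.alphaPow_integral hp hq hlam).1,
    (CosLambda.alphaPow_integral hp hq hlam).2, (CosLambda.iwasawaPow_integral hp hq hlam).1,
    CosLambda.J_const hp hq hlam⟩, CosLambda.meromorphic_gammaQuotient, ?_⟩
  rintro c hc ⟨R, hR⟩
  -- The given `R` may lie to the left of `ρ - d`, so the half-plane is shrunk to where the formula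
  -- for `c_P` is proved.
  refine CosLambda.eventuallyEq_codiscrete_of_eqOn_halfPlane hc
    CosLambda.meromorphic_gammaQuotient (R := max R (CosLambda.rho F p q - F.d)) fun lam hlam => ?_
  rw [hR lam ((le_max_left _ _).trans_lt hlam),
    (CosLambda.alphaPow_integral hp hq ((le_max_right _ _).trans_lt hlam)).2]
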